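/- Let $K$ be a field and $G$ a finite group. For a finite dimensional $KG$-module $V$ let $K[V]$ be its coordinate ring (a polynomial ring in $\dim V$ variables) with the action $(g\cdot f)(v)=f(g^{-1}v)$ and the standard grading, let $K[V]^G$ be the algebra of $G$-invariants, and let $K[V]^G_{\le d}$ be the set of $G$-invariants of degree at most $d$. Call $S\subseteq K[V]^G$ a separating set if, for all $v,w\in V$, $f(v)=f(w)$ for all $f\in S$ implies $G\cdot v=G\cdot w$. Put \[\beta(G,V)=\min\{d\in\mathbb N_0 \mid K[V]^G_{\le d}\text{ generates the }K\text{-algebra }K[V]^G\},\qquad \beta_{\mathrm{sep}}(G,V)=\min\{d\in\mathbb N_0\mid K[V]^G_{\le d}\text{ is a separating set}\},\] and let the Noether number $\beta^K(G)$ and the separating Noether number $\beta^K_{\mathrm{sep}}(G)$ be the suprema of $\beta(G,V)$ and of $\beta_{\mathrm{sep}}(G,V)$, respectively, over all finite dimensional $KG$-modules $V$. **Theorem.** Let $\mathrm{Dic}_8$ be the quaternion group of order $8$ and $\mathrm{C}_2$ the group of order $2$. If $K$ contains an element of multiplicative order $8$, then \[\beta^K_{\mathrm{sep}}(\mathrm{Dic}_8\times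 \mathrm{C}_2)=6\qquad\text{and}\qquad \beta^K(\mathrm{Dic}_8\times \mathrm{C}_2)=7;\] in particular, the separating Noether number is strictly less than the Noether number. -/

import Mathlib

/-- The action of `g` on the coordinate ring `K[V]` of `V = K^ι`: the `K`-algebra endomorphism with
`g · x_j = ∑ i, ρ(g⁻¹)_{j i} x_i`, that is, `(g · f)(v) = f (g⁻¹ v)`. -/
noncomputable def coordAct {K G ι : Type*} [Field K] [Group G] [Fintype ι] [DecidableEq ι]
    (ρ : Representation K G (ι → K)) (g : G) : MvPolynomial ι K →ₐ[K] MvPolynomial ι K :=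
  MvPolynomial.aeval fun j =>
    ∑ i, MvPolynomial.C (LinearMap.toMatrix' (ρ g⁻¹) j i) * MvPolynomial.X i

/-- As a function on `V`, the polynomial `g · f` is `v ↦ f (g⁻¹ v)`. -/
theorem eval_coordAct {K G ι : Type*} [Field K] [Group G] [Fintype ι] [DecidableEq ι]
    (ρ : Representation K G (ι → K)) (g : G) (f : MvPolynomial ι K) (v : ι → K) :
    MvPolynomial.eval v (coordAct ρ g f) = MvPolynomial.eval (ρ g⁻¹ v) f := by
  have h : (MvPolynomial.aeval v).comp (coordAct ρ g) =
      (MvPolynomial.aeval (ρ g⁻¹ v) : MvPolynomial ι K →ₐ[K] K) := by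
    apply MvPolynomial.algHom_ext
    intro j
    have hv : ρ g⁻¹ v j = ∑ i, LinearMap.toMatrix' (ρ g⁻¹) j i * v i :=
      (congrFun (LinearMap.toMatrix'_mulVec (ρ g⁻¹) v) j).symm
    simp only [AlgHom.comp_apply, coordAct, MvPolynomial.aeval_X, hv, map_sum, map_mul,
      MvPolynomial.algHom_C, Algebra.algebraMap_self, RingHom.id_apply]
  simpa [MvPolynomial.aeval_eq_eval] using DFunLike.congr_fun h f

/-- The algebra `K[V]^G` of polynomial invariants. -/
noncomputable def polyInvariants {K G ι : Type*} [Field K] [Group G] [Fintype ι] [DecidableEq ι]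
    (ρ : Representation K G (ι → K)) : Subalgebra K (MvPolynomial ι K) :=
  ⨅ g : G, AlgHom.equalizer (coordAct ρ g) (AlgHom.id K (MvPolynomial ι K))

/-- The set `K[V]^G_{≤ d}` of invariants of degree at most `d`. -/
def polyInvariantsLE {K G ι : Type*} [Field K] [Group G] [Fintype ι] [DecidableEq ι]
    (ρ : Representation K G (ι → K)) (d : ℕ) : Set (MvPolynomial ι K) :=
  {f | f ∈ polyInvariants ρ ∧ f.totalDegree ≤ d}

/-- A set `S` of polynomials is separating if any two vectors on which all members of `S` agree
lie in the same `G`-orbit. -/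
def IsSeparatingSet {K G ι : Type*} [Field K] [Group G]
    (ρ : Representation K G (ι → K)) (S : Set (MvPolynomial ι K)) : Prop :=
  ∀ v w : ι → K, (∀ f ∈ S, MvPolynomial.eval v f = MvPolynomial.eval w f) → ∃ g : G, ρ g v = w

/-- `β(G, V)`: the least `d` such that `K[V]^G_{≤ d}` generates the algebra `K[V]^G`
(`⊤` if there is none). -/
noncomputable def noetherNumberOf {K G ι : Type*} [Field K] [Group G] [Fintype ι] [DecidableEq ι]
    (ρ : Representation K G (ι → K)) : ℕ∞ :=
  ⨅ (d : ℕ) (_ : Algebra.adjoin K (polyInvariantsLE ρ d) = polyInvariants ρ), (d : ℕ∞)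

/-- `β_sep(G, V)`: the least `d` such that `K[V]^G_{≤ d}` is a separating set
(`⊤` if there is none). -/
noncomputable def sepNoetherNumberOf {K G ι : Type*} [Field K] [Group G] [Fintype ι]
    [DecidableEq ι] (ρ : Representation K G (ι → K)) : ℕ∞ :=
  ⨅ (d : ℕ) (_ : IsSeparatingSet ρ (polyInvariantsLE ρ d)), (d : ℕ∞)

/-- The Noether number `β^K(G)`: the supremum of `β(G, V)` over all finite dimensional
representations, each of which is isomorphic to one on some `K^n`. -/
noncomputable def noetherNumber (K G : Type*) [Field K] [Group G] : ℕ∞ :=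
  ⨆ (n : ℕ) (ρ : Representation K G (Fin n → K)), noetherNumberOf ρ

/-- The separating Noether number `β_sep^K(G)`: the supremum of `β_sep(G, V)` over all finite
dimensional representations, each of which is isomorphic to one on some `K^n`. -/
noncomputable def sepNoetherNumber (K G : Type*) [Field K] [Group G] : ℕ∞ :=
  ⨆ (n : ℕ) (ρ : Representation K G (Fin n → K)), sepNoetherNumberOf ρ

/-!
# The Noether number and the separating Noether number of `Dic₈ × C₂`

Let `G = Dic₈ × C₂` be generated by `i`, `j` and the generator `c` of `C₂`. The field contains a
square root `ω` of `-1` and `2` is invertible, so the linear forms on any representation are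
spanned by weight vectors for the characters of `G / {±1}`, a group of type `C₂³`, and by pairs
`(x, y)` that `i` scales by `ω` and `-ω`, that `j` maps to `(y, -x)`, and on which `c` acts by a
common sign (`mem_linSpan`, `mem_pairSpan`). Four bilinear forms in two such pairs are quadratic
weight vectors, and they span all products of a coordinate of the first pair with one of the
second. Call such a form mixed if `c` acts by different signs on the two pairs. Pairing off
coordinates of equal sign, one sees that the invariants are spanned by products of linear and
quadratic weight vectors of trivial total weight with at most one mixed factor.

*Upper bounds.* A sequence of weights with trivial product but without proper subsequences of this
kind has at most four terms. If all four of them belonged to quadratic factors, none would be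
mixed, because `c` acts trivially on the product; but then the weights lie in a Klein four-group,
where four is too many. So the invariants are generated in degrees at most `7`, and in degree `7`
only products `t q₁ q₂ q` of a linear, two unmixed and one mixed quadratic factor are needed
(`polyInvariants_le`). This gives the Noether number. Since invariants separate orbits
(`exists_map_eq_of_eval_eq`), the bound for the separating Noether number amounts to showing that
the values of `t q₁ q₂ q` are determined by those of the invariants of degree at most `6`, which
is `eval_eq_eval_of_mixed`: at a point where `q` does not vanish, one of the other three forms in
the same two pairs does not vanish either, and can be used to write `t q₁ q₂ q` as a quotient of
products of smaller invariants.

*Lower bounds.* Both are attained on the five-dimensional representation `rep5` with coordinates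
`x₁, y₁, x₂, y₂, t`. If `ζ` has order `8`, the points `(1, ζ, 0, 0, 0)` and `(1, -ζ, 0, 0, 0)` are
separated by `x₁ y₁ (x₁⁴ - y₁⁴)` but by no invariant of degree at most `5`. The product of `t`
with the three symmetric bilinear forms is an invariant of degree `7`. After restriction to `x₁ =
x₂ = x`, `y₁ = y₂ = y` it involves the monomial `x⁵ y t`, whereas the restrictions of the
invariants of degree at most `6` lie in a subalgebra (`avoiding`) whose members do not involve it.
-/

open MvPolynomial

namespace Dic8C2

/-! ### The action on the coordinate ring -/

section Action

variable {K G ι : Type*} [Field K] [Group G] [Fintype ι] [DecidableEq ι]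

theorem coordAct_mul (ρ : Representation K G (ι → K)) (g h : G) (f : MvPolynomial ι K) :
    coordAct ρ (g * h) f = coordAct ρ g (coordAct ρ h f) := by
  have key : coordAct ρ (g * h) = (coordAct ρ g).comp (coordAct ρ h) := by
    apply MvPolynomial.algHom_ext
    intro j
    simp only [AlgHom.comp_apply, coordAct, aeval_X, map_sum, map_mul, algHom_C, mul_inv_rev,
      LinearMap.toMatrix'_mul, Matrix.mul_apply, algebraMap_eq, Finset.sum_mul, Finset.mul_sum]
    rw [Finset.sum_comm]
    simp only [mul_assoc]
  rw [key, AlgHom.comp_apply]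

theorem coordAct_one (ρ : Representation K G (ι → K)) (f : MvPolynomial ι K) :
    coordAct ρ 1 f = f := by
  have key : coordAct ρ 1 = AlgHom.id K (MvPolynomial ι K) := by
    apply MvPolynomial.algHom_ext
    intro j
    simp [coordAct, Pi.single_apply, apply_ite (C : K → MvPolynomial ι K)]
  rw [key, AlgHom.id_apply]

theorem mem_polyInvariants {ρ : Representation K G (ι → K)} {f : MvPolynomial ι K} :
    f ∈ polyInvariants ρ ↔ ∀ g, coordAct ρ g f = f := by
  simp [polyInvariants, Algebra.mem_iInf]

theorem totalDegree_coordAct_X_le (ρ : Representation K G (ι → K)) (g : G) (j : ι) :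
    (coordAct ρ g (X j)).totalDegree ≤ 1 := by
  simp only [coordAct, aeval_X]
  refine (totalDegree_finsetSum _ _).trans (Finset.sup_le fun i _ => ?_)
  refine (totalDegree_mul _ _).trans ?_
  simp

theorem totalDegree_coordAct_le (ρ : Representation K G (ι → K)) (g : G)
    (f : MvPolynomial ι K) : (coordAct ρ g f).totalDegree ≤ f.totalDegree := by
  conv_lhs => rw [f.as_sum, map_sum]
  refine (totalDegree_finsetSum _ _).trans (Finset.sup_le fun s hs => ?_)
  rw [monomial_eq, map_mul, algHom_C, algebraMap_eq, Finsupp.prod, map_prod]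
  refine (totalDegree_mul _ _).trans ?_
  rw [totalDegree_C, zero_add]
  refine (totalDegree_finsetProd _ _).trans ?_
  refine le_trans (Finset.sum_le_sum fun i _ => ?_) (le_totalDegree hs)
  rw [map_pow]
  exact (totalDegree_pow _ _).trans
    ((Nat.mul_le_mul_left _ (totalDegree_coordAct_X_le ρ g i)).trans_eq (mul_one _))

/-- Over any field, the polynomial invariants of a finite group separate its orbits. If `v` is
not in the orbit of `w`, some `P` takes the value `1` at `v` and vanishes on the orbit of `w`; the
product of the translates of `1 - P` is an invariant that is `0` at `v` and `1` at `w`. -/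
theorem exists_map_eq_of_eval_eq [Finite G] (ρ : Representation K G (ι → K)) (v w : ι → K)
    (h : ∀ f ∈ polyInvariants ρ, eval v f = eval w f) : ∃ g, ρ g v = w := by
  classical
  cases nonempty_fintype G
  by_contra! hne
  have hne' : ∀ g, ∃ k, ρ g w k ≠ v k := by
    intro g
    by_contra! hk
    apply hne g⁻¹
    rw [← funext hk, ← Module.End.mul_apply, ← map_mul]
    simp
  choose k hk using hne'
  let P : MvPolynomial ι K :=
    ∏ g, C (v (k g) - ρ g w (k g))⁻¹ * (X (k g) - C (ρ g w (k g)))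
  have hPv : eval v P = 1 := by
    simp only [P, map_prod, map_mul, map_sub, eval_C, eval_X]
    exact Finset.prod_eq_one fun g _ => inv_mul_cancel₀ (sub_ne_zero.2 (hk g).symm)
  have hPw : ∀ g, eval (ρ g w) P = 0 := fun g => by
    simp only [P, map_prod, map_mul, map_sub, eval_C, eval_X]
    exact Finset.prod_eq_zero (Finset.mem_univ g) (by simp)
  let F : MvPolynomial ι K := ∏ g, coordAct ρ g (1 - P)
  have hF : F ∈ polyInvariants ρ := by
    refine mem_polyInvariants.2 fun g => ?_
    simp only [F, map_prod, ← coordAct_mul]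
    exact Fintype.prod_equiv (Equiv.mulLeft g) _ _ fun _ => rfl
  have h1 : eval v F = 0 := by
    simp only [F, map_prod, eval_coordAct]
    exact Finset.prod_eq_zero (Finset.mem_univ 1) (by simp [hPv])
  have h2 : eval w F = 1 := by
    simp only [F, map_prod, eval_coordAct]
    exact Finset.prod_eq_one fun g _ => by simp [hPw]
  exact zero_ne_one ((h1.symm.trans (h F hF)).trans h2)

/-- The sum of all translates of a polynomial `f` vanishes if some group element maps `f`
to `-f`. -/
theorem sum_coordAct_eq_zero [Fintype G] (h2 : (2 : K) ≠ 0) (ρ : Representation K G (ι → K))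
    (g₀ : G) {f : MvPolynomial ι K} (hf : coordAct ρ g₀ f = -f) : ∑ g, coordAct ρ g f = 0 := by
  have h : ∑ g, coordAct ρ g f = -∑ g, coordAct ρ g f := by
    rw [← Finset.sum_neg_distrib]
    refine (Fintype.sum_equiv (Equiv.mulRight g₀) _ _ fun g => ?_).symm
    rw [Equiv.coe_mulRight, coordAct_mul, hf, map_neg]
  have h3 : (2 : K) • ∑ g, coordAct ρ g f = 0 := by
    rw [two_smul]; nth_rw 1 [h]; exact neg_add_cancel _
  exact (smul_eq_zero.1 h3).resolve_left h2

end Action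

/-! ### Zero-sum sequences over elementary abelian 2-groups -/

theorem exists_le_of_le_card {α : Type*} (s : Multiset α) {n : ℕ} (h : n ≤ s.card) :
    ∃ t ≤ s, t.card = n := by
  induction s using Quotient.inductionOn with | _ l
  exact ⟨(l.take n : List α), (List.take_sublist n l).subperm, by simpa using h⟩

/-- A sequence of length `n` over an elementary abelian 2-group `H` with fewer than `2 ^ n`
elements has a nonempty subsequence with product one: two of its `2 ^ n` subsequences have the same
product, and their symmetric difference has product one. -/
theorem exists_le_prod_eq_one {α H : Type*} [CommGroup H] [Fintype H]
    (hH : ∀ x : H, x * x = 1) (w : α → H) (s : Multiset α)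
    (hs : Fintype.card H < 2 ^ s.card) : ∃ t ≤ s, t ≠ 0 ∧ (t.map w).prod = 1 := by
  classical
  induction s using Quotient.inductionOn with | _ l
  let F : Finset (Fin l.length) → H := fun A => ∏ k ∈ A, w (l.get k)
  obtain ⟨A, B, hAB, hF⟩ := Fintype.exists_ne_map_eq_of_card_lt F (by simpa using hs)
  have hle : (symmDiff A B).val.map l.get ≤ (l : Multiset α) := by
    calc (symmDiff A B).val.map l.get ≤ (Finset.univ : Finset (Fin l.length)).val.map l.get :=
          Multiset.map_le_map (Finset.val_le_iff.2 (Finset.subset_univ _))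
      _ = l := by
          rw [Fin.univ_val_map]; simp
  refine ⟨_, hle, ?_, ?_⟩
  · simpa [Multiset.map_eq_zero, Finset.val_eq_zero, symmDiff_eq_bot] using hAB
  · rw [Multiset.map_map]
    change ∏ k ∈ symmDiff A B, w (l.get k) = 1
    have hd : Disjoint (A \ B) (B \ A) := disjoint_sdiff_sdiff
    have e : symmDiff A B = (A \ B) ∪ (B \ A) := rfl
    rw [e, Finset.prod_union hd]
    have hA := Finset.prod_inter_mul_prod_sdiff A B (fun k => w (l.get k))
    have hB := Finset.prod_inter_mul_prod_sdiff B A (fun k => w (l.get k))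
    have : (∏ k ∈ A \ B, w (l.get k)) = ∏ k ∈ B \ A, w (l.get k) := by
      change F A = F B at hF
      simp only [F] at hF
      rw [← hA, ← hB, Finset.inter_comm B A] at hF
      exact mul_left_cancel hF
    rw [this, hH]

/-! ### Quadratic semi-invariants -/

/-- For pairs `(x, y)` and `(x', y')` in a commutative ring, the four bilinear forms
`x y' - y x'`, `x y' + y x'`, `x x' + y y'`, `x x' - y y'`. They are labelled by a pair of signs `ψ`
so that, on a tensor product of two copies of the two-dimensional representation of `Dic₈`, the
generators `i` and `j` multiply the form labelled `ψ` by `ψ.1` and `ψ.2`. -/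
def bil {R : Type*} [CommRing R] (ψ : ℤˣ × ℤˣ) (x y x' y' : R) : R :=
  if ψ.1 = 1 then x * y' - ((ψ.2 : ℤ) : R) * (y * x') else x * x' + ((ψ.2 : ℤ) : R) * (y * y')

theorem map_bil {R S : Type*} [CommRing R] [CommRing S] (f : R →+* S) (ψ : ℤˣ × ℤˣ)
    (x y x' y' : R) : f (bil ψ x y x' y') = bil ψ (f x) (f y) (f x') (f y') := by
  unfold bil
  split_ifs <;> simp

/-- A bilinear form on a product of two planes that does not vanish at a point is not the only one
of the four forms with this property, since
`(x x' + y y')² - (x x' - y y')² = (x y' + y x')² - (x y' - y x')²`. -/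
theorem exists_ne_bil_ne_zero {F : Type*} [Field F] (ψ : ℤˣ × ℤˣ) (x y x' y' : F)
    (h : bil ψ x y x' y' ≠ 0) : ∃ ψ', ψ' ≠ ψ ∧ bil ψ' x y x' y' ≠ 0 := by
  by_contra! hc
  apply h
  obtain ⟨ε, η⟩ := ψ
  have h1 := hc (1, 1)
  have h2 := hc (1, -1)
  have h3 := hc (-1, 1)
  have h4 := hc (-1, -1)
  rw [← sq_eq_zero_iff]
  rcases Int.units_eq_one_or ε with rfl | rfl <;> rcases Int.units_eq_one_or η with rfl | rfl <;>
    simp [bil] at h1 h2 h3 h4 ⊢ <;> grind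

/-- The product of the two forms with labels `ψ ≠ ψ'`, evaluated at two vectors, is a combination
of products of forms evaluated at pairs of equal vectors; only the two nontrivial labels `a`, `b`
with `a b = ψ ψ'` occur. -/
theorem two_mul_bil_mul_bil {R : Type*} [CommRing R] (a b ψ ψ' : ℤˣ × ℤˣ) (ha : a ≠ 1)
    (hb : b ≠ 1) (hab : a ≠ b) (h : ψ * ψ' = a * b) :
    ∃ k l : ℤˣ, ∀ x y x' y' : R, 2 * (bil ψ x y x' y' * bil ψ' x y x' y') =
      ((k : ℤ) : R) * (bil a x y x y * bil b x' y' x' y') +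
        ((l : ℤ) : R) * (bil b x y x y * bil a x' y' x' y') := by
  obtain rfl : ψ' = ψ * (a * b) := by
    rw [← h, ← mul_assoc, Prod.ext_iff]; simp
  clear h
  obtain ⟨a₁, a₂⟩ := a
  obtain ⟨b₁, b₂⟩ := b
  obtain ⟨ε, η⟩ := ψ
  rcases Int.units_eq_one_or a₁ with rfl | rfl <;> rcases Int.units_eq_one_or a₂ with rfl | rfl <;>
  rcases Int.units_eq_one_or b₁ with rfl | rfl <;> rcases Int.units_eq_one_or b₂ with rfl | rfl <;>
  first
  | exact absurd rfl ha
  | exact absurd rfl hb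
  | exact absurd rfl hab
  | rcases Int.units_eq_one_or ε with rfl | rfl <;> rcases Int.units_eq_one_or η with rfl | rfl <;>
    first
    | exact ⟨1, 1, fun x y x' y' => by simp [bil]; ring1⟩
    | exact ⟨1, -1, fun x y x' y' => by simp [bil]; ring1⟩
    | exact ⟨-1, 1, fun x y x' y' => by simp [bil]; ring1⟩

/-! ### Weight vectors -/

theorem totalDegree_intCast_units_mul_le {K ι : Type*} [Field K] (η : ℤˣ) (f : MvPolynomial ι K) :
    (((η : ℤ) : MvPolynomial ι K) * f).totalDegree ≤ f.totalDegree := by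
  rcases Int.units_eq_one_or η with rfl | rfl <;> simp

theorem totalDegree_mul_le_of_le {K ι : Type*} [Field K] {f g : MvPolynomial ι K} {m n : ℕ}
    (hf : f.totalDegree ≤ m) (hg : g.totalDegree ≤ n) : (f * g).totalDegree ≤ m + n :=
  (totalDegree_mul f g).trans (Nat.add_le_add hf hg)

/-- The group `Dic₈ × C₂`. -/
abbrev Q8C2 := QuaternionGroup 2 × Multiplicative (ZMod 2)

/-- The generator `i` of `Dic₈`. -/
def gI : Q8C2 := (QuaternionGroup.a 1, 1)

/-- The generator `j` of `Dic₈`. -/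
def gJ : Q8C2 := (QuaternionGroup.xa 0, 1)

/-- The generator of `C₂`. -/
def gC : Q8C2 := (1, Multiplicative.ofAdd 1)

theorem exists_eq_mul_pow (g : Q8C2) :
    ∃ (k : Fin 2) (l : Fin 4) (m : Fin 2), g = gJ ^ k.1 * gI ^ l.1 * gC ^ m.1 := by
  revert g; decide

section WeightVectors

variable {K ι : Type*} [Field K] [Fintype ι] [DecidableEq ι]
  (ρ : Representation K Q8C2 (ι → K))

/-- The polynomial `f` is a weight vector of weight `χ`: the generators `i`, `j` and the generator
of `C₂` multiply it by the three signs in `χ`. -/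
def HasWeight (f : MvPolynomial ι K) (χ : (ℤˣ × ℤˣ) × ℤˣ) : Prop :=
  coordAct ρ gI f = ((χ.1.1 : ℤ) : MvPolynomial ι K) * f ∧
    coordAct ρ gJ f = ((χ.1.2 : ℤ) : MvPolynomial ι K) * f ∧
      coordAct ρ gC f = ((χ.2 : ℤ) : MvPolynomial ι K) * f

variable {ρ}

theorem HasWeight.one : HasWeight ρ 1 1 := by simp [HasWeight]

theorem HasWeight.mul {f f' : MvPolynomial ι K} {χ χ' : (ℤˣ × ℤˣ) × ℤˣ} (h : HasWeight ρ f χ)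
    (h' : HasWeight ρ f' χ') : HasWeight ρ (f * f') (χ * χ') := by
  obtain ⟨h1, h2, h3⟩ := h
  obtain ⟨h1', h2', h3'⟩ := h'
  refine ⟨?_, ?_, ?_⟩ <;> simp only [map_mul, *, Prod.fst_mul, Prod.snd_mul, Units.val_mul,
    Int.cast_mul] <;> ring

theorem HasWeight.mem_polyInvariants {f : MvPolynomial ι K} (h : HasWeight ρ f 1) :
    f ∈ polyInvariants ρ := by
  obtain ⟨h1, h2, h3⟩ := h
  simp only [Prod.fst_one, Prod.snd_one, Units.val_one, Int.cast_one, one_mul] at h1 h2 h3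
  have hpow : ∀ g, coordAct ρ g f = f → ∀ n : ℕ, coordAct ρ (g ^ n) f = f := by
    intro g hg n
    induction n with
    | zero => rw [pow_zero, coordAct_one]
    | succ n ih => rw [pow_succ, coordAct_mul, hg, ih]
  refine Dic8C2.mem_polyInvariants.2 fun g => ?_
  obtain ⟨k, l, m, rfl⟩ := exists_eq_mul_pow g
  rw [coordAct_mul, coordAct_mul, hpow _ h3, hpow _ h1, hpow _ h2]

/-- The Reynolds operator kills weight vectors of nontrivial weight. -/
theorem HasWeight.sum_coordAct (h2 : (2 : K) ≠ 0) {f : MvPolynomial ι K} {χ : (ℤˣ × ℤˣ) × ℤˣ}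
    (h : HasWeight ρ f χ) (hχ : χ ≠ 1) : ∑ g, coordAct ρ g f = 0 := by
  obtain ⟨h1, h2', h3⟩ := h
  obtain ⟨⟨ε, η⟩, δ⟩ := χ
  rcases Int.units_eq_one_or ε with rfl | rfl
  · rcases Int.units_eq_one_or η with rfl | rfl
    · rcases Int.units_eq_one_or δ with rfl | rfl
      · exact absurd rfl hχ
      · exact sum_coordAct_eq_zero h2 ρ gC (by simpa using h3)
    · exact sum_coordAct_eq_zero h2 ρ gJ (by simpa using h2')
  · exact sum_coordAct_eq_zero h2 ρ gI (by simpa using h1)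

/-! ### Coordinates of the two-dimensional constituents -/

variable (ρ) in
/-- A pair of linear forms transforming like a basis of the two-dimensional irreducible
representation of `Dic₈ × C₂` on which `C₂` acts by the sign `e`, the basis consisting of
eigenvectors of the generator `i`. Both forms may be zero. Here `ω` is a fixed square root of `-1`;
homogeneity is not needed, only the bound on the degrees. -/
structure CoordPair (ω : K) (e : ℤˣ) where
  /-- The coordinate on which `i` acts as `ω`. -/
  x : MvPolynomial ι K
  /-- The coordinate on which `i` acts as `-ω`. -/
  y : MvPolynomial ι K
  degree_x : x.totalDegree ≤ 1
  degree_y : y.totalDegree ≤ 1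
  act_i_x : coordAct ρ gI x = C ω * x
  act_i_y : coordAct ρ gI y = -(C ω * y)
  act_j_x : coordAct ρ gJ x = y
  act_j_y : coordAct ρ gJ y = -x
  act_c_x : coordAct ρ gC x = ((e : ℤ) : MvPolynomial ι K) * x
  act_c_y : coordAct ρ gC y = ((e : ℤ) : MvPolynomial ι K) * y

/-- The quadratic weight vector attached to two coordinate pairs and a label. -/
noncomputable def CoordPair.bil {ω : K} {e e' : ℤˣ} (p : CoordPair ρ ω e) (p' : CoordPair ρ ω e')
    (ψ : ℤˣ × ℤˣ) : MvPolynomial ι K :=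
  Dic8C2.bil ψ p.x p.y p'.x p'.y

theorem CoordPair.hasWeight_bil {ω : K} (hω : ω ^ 2 = -1) {e e' : ℤˣ} (p : CoordPair ρ ω e)
    (p' : CoordPair ρ ω e') (ψ : ℤˣ × ℤˣ) : HasWeight ρ (p.bil p' ψ) (ψ, e * e') := by
  obtain ⟨ε, η⟩ := ψ
  have hC : (C ω : MvPolynomial ι K) * C ω = -1 := by
    rw [← C_mul, ← sq, hω]; simp
  have hη : ((η : ℤ) : MvPolynomial ι K) * ((η : ℤ) : MvPolynomial ι K) = 1 := by
    rw [← Int.cast_mul, Int.units_coe_mul_self, Int.cast_one]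
  have map' : ∀ g, coordAct ρ g (p.bil p' (ε, η)) = Dic8C2.bil (ε, η) (coordAct ρ g p.x)
      (coordAct ρ g p.y) (coordAct ρ g p'.x) (coordAct ρ g p'.y) :=
    fun g => map_bil (coordAct ρ g : MvPolynomial ι K →+* MvPolynomial ι K) _ _ _ _ _
  refine ⟨?_, ?_, ?_⟩
  · rw [map', p.act_i_x, p.act_i_y, p'.act_i_x, p'.act_i_y]
    rcases Int.units_eq_one_or ε with rfl | rfl
    · simp only [CoordPair.bil, Dic8C2.bil, if_true, Units.val_one, Int.cast_one]
      linear_combination (-p.x * p'.y + ((η : ℤ) : MvPolynomial ι K) * (p.y * p'.x)) * hC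
    · simp [CoordPair.bil, Dic8C2.bil]
      linear_combination (p.x * p'.x + ((η : ℤ) : MvPolynomial ι K) * (p.y * p'.y)) * hC
  · rw [map', p.act_j_x, p.act_j_y, p'.act_j_x, p'.act_j_y]
    rcases Int.units_eq_one_or ε with rfl | rfl
    · simp [CoordPair.bil, Dic8C2.bil]
      linear_combination (p.y * p'.x) * hη
    · simp [CoordPair.bil, Dic8C2.bil]
      linear_combination -(p.y * p'.y) * hη
  · rw [map', p.act_c_x, p.act_c_y, p'.act_c_x, p'.act_c_y]
    rcases Int.units_eq_one_or ε with rfl | rfl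
    · simp [CoordPair.bil, Dic8C2.bil]; ring
    · simp [CoordPair.bil, Dic8C2.bil]; ring

theorem CoordPair.totalDegree_bil_le {ω : K} {e e' : ℤˣ} (p : CoordPair ρ ω e)
    (p' : CoordPair ρ ω e') (ψ : ℤˣ × ℤˣ) : (p.bil p' ψ).totalDegree ≤ 2 := by
  unfold CoordPair.bil Dic8C2.bil
  split_ifs
  · refine (totalDegree_sub _ _).trans (max_le ?_ ?_)
    · exact totalDegree_mul_le_of_le p.degree_x p'.degree_y
    · exact (totalDegree_intCast_units_mul_le _ _).trans
        (totalDegree_mul_le_of_le p.degree_y p'.degree_x)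
  · refine (totalDegree_add _ _).trans (max_le ?_ ?_)
    · exact totalDegree_mul_le_of_le p.degree_x p'.degree_x
    · exact (totalDegree_intCast_units_mul_le _ _).trans
        (totalDegree_mul_le_of_le p.degree_y p'.degree_y)

/-- An eigenvector of `i` with eigenvalue `ω` and its translate under `j` form a pair. -/
noncomputable def CoordPair.ofEigenvector {ω : K} (hω : ω ^ 2 = -1) {e : ℤˣ} (x : MvPolynomial ι K)
    (hd : x.totalDegree ≤ 1) (hi : coordAct ρ gI x = C ω * x)
    (hc : coordAct ρ gC x = ((e : ℤ) : MvPolynomial ι K) * x) : CoordPair ρ ω e :=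
  have hC : (C ω : MvPolynomial ι K) * C ω = -1 := by
    rw [← C_mul, ← sq, hω]; simp
  have hii : coordAct ρ (gI * gI) x = -x := by
    rw [coordAct_mul, hi, map_mul, algHom_C, algebraMap_eq, hi, ← mul_assoc, hC, neg_one_mul]
  have hjj : coordAct ρ gJ (coordAct ρ gJ x) = -x := by
    rw [← coordAct_mul, show gJ * gJ = gI * gI from rfl, hii]
  { x := x
    y := coordAct ρ gJ x
    degree_x := hd
    degree_y := (totalDegree_coordAct_le ρ gJ x).trans hd
    act_i_x := hi
    act_i_y := by
      rw [← coordAct_mul, show gI * gJ = gJ * (gI * (gI * gI)) by decide, coordAct_mul,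
        coordAct_mul, hii, map_neg, map_neg, hi, map_mul, algHom_C, algebraMap_eq]
    act_j_x := rfl
    act_j_y := hjj
    act_c_x := hc
    act_c_y := by
      rw [← coordAct_mul, show gC * gJ = gJ * gC by decide, coordAct_mul, hc, map_mul,
        map_intCast] }

end WeightVectors

section Upper

variable {K ι : Type*} [Field K] [Fintype ι] [DecidableEq ι]
  {ρ : Representation K Q8C2 (ι → K)} {ω : K}

/-! ### Products of weight vectors -/

variable (ρ ω) in
/-- The weight vectors used as building blocks for invariants: linear ones, and the quadratic ones
attached to two coordinate pairs. -/
inductive Gen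
  | lin (t : MvPolynomial ι K) (χ : (ℤˣ × ℤˣ) × ℤˣ) (hd : t.totalDegree ≤ 1)
      (hw : HasWeight ρ t χ)
  | quad (e e' : ℤˣ) (p : CoordPair ρ ω e) (p' : CoordPair ρ ω e') (ψ : ℤˣ × ℤˣ)

namespace Gen

/-- The underlying polynomial. -/
noncomputable def val : Gen ρ ω → MvPolynomial ι K
  | lin t _ _ _ => t
  | quad _ _ p p' ψ => p.bil p' ψ

/-- The weight. -/
def wt : Gen ρ ω → (ℤˣ × ℤˣ) × ℤˣ
  | lin _ χ _ _ => χ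
  | quad e e' _ _ ψ => (ψ, e * e')

/-- The formal degree, an upper bound for the degree of the underlying polynomial. -/
def deg : Gen ρ ω → ℕ
  | lin _ _ _ _ => 1
  | quad _ _ _ _ _ => 2

/-- A quadratic block is mixed if `C₂` acts differently on its two coordinate pairs. -/
def Mixed : Gen ρ ω → Prop
  | lin _ _ _ _ => False
  | quad e e' _ _ _ => e ≠ e'

instance : DecidablePred (Mixed : Gen ρ ω → Prop)
  | lin _ _ _ _ => inferInstanceAs (Decidable False)
  | quad e e' _ _ _ => inferInstanceAs (Decidable (e ≠ e'))

theorem hasWeight (hω : ω ^ 2 = -1) : ∀ g : Gen ρ ω, HasWeight ρ g.val g.wt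
  | lin _ _ _ hw => hw
  | quad _ _ p p' ψ => p.hasWeight_bil hω p' ψ

theorem totalDegree_val_le : ∀ g : Gen ρ ω, g.val.totalDegree ≤ g.deg
  | lin _ _ hd _ => hd
  | quad _ _ p p' ψ => p.totalDegree_bil_le p' ψ

theorem hasWeight_prod (hω : ω ^ 2 = -1) (s : Multiset (Gen ρ ω)) :
    HasWeight ρ (s.map val).prod (s.map wt).prod := by
  induction s using Multiset.induction with
  | empty => simpa using HasWeight.one
  | cons g s ih => simpa using (g.hasWeight hω).mul ih

theorem totalDegree_prod_le (s : Multiset (Gen ρ ω)) :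
    (s.map val).prod.totalDegree ≤ (s.map deg).sum := by
  induction s using Multiset.induction with
  | empty => simp
  | cons g s ih => simpa using totalDegree_mul_le_of_le g.totalDegree_val_le ih

theorem sum_deg_le (s : Multiset (Gen ρ ω)) : (s.map deg).sum ≤ 2 * s.card := by
  induction s using Multiset.induction with
  | empty => simp
  | cons g s ih =>
    have : g.deg ≤ 2 := by cases g <;> simp [deg]
    simp only [Multiset.map_cons, Multiset.sum_cons, Multiset.card_cons]; omega

theorem mul_self_signs {α : Type*} [Monoid α] (h : ∀ x : α, x * x = 1) (x : α × ℤˣ) :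
    x * x = 1 := Prod.ext (h _) (Int.units_mul_self _)

/-- The weights of unmixed quadratic blocks lie in a Klein four-group, so any three of them have a
nonempty subsequence with trivial product. -/
theorem exists_le_of_unmixed (s : Multiset (Gen ρ ω)) (hs : 3 ≤ s.card)
    (hq : ∀ g ∈ s, g.deg = 2 ∧ ¬ g.Mixed) : ∃ t ≤ s, t ≠ 0 ∧ (t.map wt).prod = 1 := by
  obtain ⟨t, hts, ht0, ht⟩ := exists_le_prod_eq_one
    (mul_self_signs Int.units_mul_self) (fun g : Gen ρ ω => g.wt.1) s
    (lt_of_lt_of_le (by decide) (Nat.pow_le_pow_right two_pos hs))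
  refine ⟨t, hts, ht0, Prod.ext ?_ ?_⟩
  · rw [Prod.fst_one, ← ht]
    exact (Multiset.prod_hom (t.map wt) (MonoidHom.fst (ℤˣ × ℤˣ) ℤˣ)).symm.trans
      (by rw [Multiset.map_map]; rfl)
  · refine (Multiset.prod_hom (t.map wt) (MonoidHom.snd (ℤˣ × ℤˣ) ℤˣ)).symm.trans ?_
    rw [Multiset.map_map]
    refine Multiset.prod_eq_one fun x hx => ?_
    obtain ⟨g, hg, rfl⟩ := Multiset.mem_map.1 hx
    obtain ⟨h1, h2⟩ := hq g (Multiset.mem_of_le hts hg)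
    cases g with
    | lin => simp [deg] at h1
    | quad e e' p p' ψ =>
      have : e = e' := not_not.1 h2
      subst this
      exact Int.units_mul_self _

/-- A subalgebra that contains all invariants of degree at most `6` and all products of trivial
weight of a linear, two unmixed and a mixed quadratic weight vector contains every product of
trivial weight with at most one mixed factor. Only products without proper subproducts of trivial
weight matter; these have at most four factors since the weights lie in a group of type `C₂³`,
and four quadratic factors are excluded because without a mixed factor their weights lie in a
Klein four-group. -/
theorem prod_mem (hω : ω ^ 2 = -1) (P : Subalgebra K (MvPolynomial ι K))
    (h6 : ∀ f ∈ polyInvariantsLE ρ 6, f ∈ P)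
    (h7 : ∀ (t : MvPolynomial ι K) (χ : (ℤˣ × ℤˣ) × ℤˣ), t.totalDegree ≤ 1 → HasWeight ρ t χ →
      ∀ (e₁ e₂ e e' : ℤˣ) (p₁ p₁' : CoordPair ρ ω e₁) (p₂ p₂' : CoordPair ρ ω e₂)
        (p : CoordPair ρ ω e) (p' : CoordPair ρ ω e') (a b ψ : ℤˣ × ℤˣ), e ≠ e' → a ≠ 1 → b ≠ 1 →
        a ≠ b → χ * ((a, 1) * ((b, 1) * (ψ, e * e'))) = 1 →
        t * (p₁.bil p₁' a * (p₂.bil p₂' b * p.bil p' ψ)) ∈ P)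
    (s : Multiset (Gen ρ ω)) (hm : s.countP Mixed ≤ 1) (hw : (s.map wt).prod = 1) :
    (s.map val).prod ∈ P := by
  induction hn : s.card using Nat.strong_induction_on generalizing s with | _ n ih
  subst hn
  by_cases hsplit : ∃ t ≤ s, t ≠ 0 ∧ t ≠ s ∧ (t.map wt).prod = 1
  · obtain ⟨t, hts, ht0, hne, ht⟩ := hsplit
    obtain ⟨u, rfl⟩ := Multiset.le_iff_exists_add.1 hts
    have hu0 : u ≠ 0 := by rintro rfl; simp at hne
    have h1 := Multiset.card_pos.2 ht0
    have h2 := Multiset.card_pos.2 hu0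
    rw [Multiset.countP_add] at hm
    rw [Multiset.map_add, Multiset.prod_add, ht, one_mul] at hw
    rw [Multiset.map_add, Multiset.prod_add]
    rw [Multiset.card_add] at ih
    exact mul_mem (ih _ (by omega) t (by omega) ht rfl) (ih _ (by omega) u (by omega) hw rfl)
  have hmin : ∀ t ≤ s, t ≠ 0 → (t.map wt).prod = 1 → t = s := fun t h1 h2 h3 => by
    by_contra h4; exact hsplit ⟨t, h1, h2, h4, h3⟩
  have hcard : s.card ≤ 4 := by
    by_contra! hc
    obtain ⟨u, hus, hu⟩ := exists_le_of_le_card s (n := 4) (by omega)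
    obtain ⟨t, htu, ht0, ht⟩ := exists_le_prod_eq_one
      (mul_self_signs (mul_self_signs Int.units_mul_self)) (wt : Gen ρ ω → _) u
      (by rw [hu]; decide)
    have := Multiset.card_le_card htu
    rw [hmin t (htu.trans hus) ht0 ht] at this
    omega
  by_cases hd : (s.map deg).sum ≤ 6
  · refine h6 _ ⟨HasWeight.mem_polyInvariants ?_, (totalDegree_prod_le s).trans hd⟩
    rw [← hw]; exact hasWeight_prod hω s
  have hsum := sum_deg_le s
  have hcard4 : s.card = 4 := by omega
  by_cases hl : ∃ g ∈ s, g.deg = 1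
  · obtain ⟨g, hg, hg1⟩ := hl
    obtain ⟨s', rfl⟩ := Multiset.exists_cons_of_mem hg
    have hs' : s'.card = 3 := by simpa using hcard4
    have hdeg : ∀ x ∈ s', x.deg = 2 := by
      intro x hx
      obtain ⟨s'', rfl⟩ := Multiset.exists_cons_of_mem hx
      have := sum_deg_le s''
      simp only [Multiset.map_cons, Multiset.sum_cons, Multiset.card_cons] at hd hs' this
      have : x.deg ≤ 2 := by cases x <;> simp [deg]
      omega
    by_cases hmx : ∃ m ∈ s', m.Mixed
    · obtain ⟨m, hms, hmm⟩ := hmx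
      obtain ⟨s'', rfl⟩ := Multiset.exists_cons_of_mem hms
      obtain ⟨q₁, q₂, rfl⟩ := Multiset.card_eq_two.1 (by simpa using hs')
      have hd1 := hdeg q₁ (by simp)
      have hd2 := hdeg q₂ (by simp)
      have hm1 : ¬ q₁.Mixed := fun h => by
        have := Multiset.countP_le_of_le Mixed
          (show (m ::ₘ {q₁} : Multiset (Gen ρ ω)) ≤ g ::ₘ m ::ₘ {q₁, q₂} from
            (Multiset.cons_le_cons _ (by simp)).trans (Multiset.le_cons_self _ _))
        have h' : Multiset.countP Mixed (m ::ₘ {q₁} : Multiset (Gen ρ ω)) = 2 := by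
          rw [Multiset.countP_cons_of_pos _ hmm, ← Multiset.cons_zero,
            Multiset.countP_cons_of_pos _ h, Multiset.countP_zero]
        omega
      have hm2 : ¬ q₂.Mixed := fun h => by
        have := Multiset.countP_le_of_le Mixed
          (show (m ::ₘ {q₂} : Multiset (Gen ρ ω)) ≤ g ::ₘ m ::ₘ {q₁, q₂} from
            (Multiset.cons_le_cons _ (by simp)).trans (Multiset.le_cons_self _ _))
        have h' : Multiset.countP Mixed (m ::ₘ {q₂} : Multiset (Gen ρ ω)) = 2 := by
          rw [Multiset.countP_cons_of_pos _ hmm, ← Multiset.cons_zero,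
            Multiset.countP_cons_of_pos _ h, Multiset.countP_zero]
        omega
      cases g with
      | quad => simp [deg] at hg1
      | lin t χ htd htw =>
      cases m with
      | lin => exact hmm.elim
      | quad e e' p p' ψ =>
      cases q₁ with
      | lin => simp [deg] at hd1
      | quad e₁ e₁' p₁ p₁' a =>
      cases q₂ with
      | lin => simp [deg] at hd2
      | quad e₂ e₂' p₂ p₂' b =>
      obtain rfl : e₁ = e₁' := not_not.1 hm1
      obtain rfl : e₂ = e₂' := not_not.1 hm2
      have hsmall : ∀ u ≤ (Gen.lin t χ htd htw ::ₘ Gen.quad e e' p p' ψ ::ₘ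
          {Gen.quad e₁ e₁ p₁ p₁' a, Gen.quad e₂ e₂ p₂ p₂' b} : Multiset (Gen ρ ω)),
          u ≠ 0 → u.card ≤ 2 → (u.map wt).prod ≠ 1 := fun u h1 h2 h3 h4 => by
        have := hmin u h1 h2 h4
        rw [this] at h3
        simp at h3
      have ha : a ≠ 1 := by
        rintro rfl
        refine hsmall {Gen.quad e₁ e₁ p₁ p₁' 1} (by simp) (by simp) (by simp) ?_
        simp [wt]
      have hb : b ≠ 1 := by
        rintro rfl
        refine hsmall {Gen.quad e₂ e₂ p₂ p₂' 1} (by simp) (by simp) (by simp) ?_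
        simp [wt]
      have hab : a ≠ b := by
        rintro rfl
        refine hsmall {Gen.quad e₁ e₁ p₁ p₁' a, Gen.quad e₂ e₂ p₂ p₂' a}
          ((Multiset.le_cons_self _ _).trans (Multiset.le_cons_self _ _)) (by simp) (by simp) ?_
        simp [wt, Prod.ext_iff]
      have := h7 t χ htd htw e₁ e₂ e e' p₁ p₁' p₂ p₂' p p' a b ψ hmm ha hb hab (by
        rw [← hw]
        simp only [Multiset.map_cons, Multiset.prod_cons, Multiset.insert_eq_cons,
          Multiset.map_singleton, Multiset.prod_singleton, wt, Int.units_mul_self]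
        simp only [mul_left_comm, mul_comm])
      convert this using 1
      simp only [Multiset.map_cons, Multiset.prod_cons, Multiset.insert_eq_cons,
        Multiset.map_singleton, Multiset.prod_singleton, val]
      ring
    · push Not at hmx
      obtain ⟨t, hts, ht0, ht⟩ := exists_le_of_unmixed s' hs'.ge fun x hx => ⟨hdeg x hx, hmx x hx⟩
      have h1 := Multiset.card_le_card hts
      rw [hmin t (hts.trans (Multiset.le_cons_self _ _)) ht0 ht] at h1
      simp at h1
  · push Not at hl
    have hdeg : ∀ x ∈ s, x.deg = 2 := fun x hx => by
      have := hl x hx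
      cases x with
      | lin => exact absurd rfl this
      | quad => rfl
    exfalso
    by_cases hmx : ∃ m ∈ s, m.Mixed
    · -- The sign of `C₂` on a product with exactly one mixed quadratic factor is `-1`.
      obtain ⟨m, hms, hmm⟩ := hmx
      obtain ⟨s', rfl⟩ := Multiset.exists_cons_of_mem hms
      rw [Multiset.countP_cons_of_pos _ hmm] at hm
      have h0 : s'.countP Mixed = 0 := by omega
      rw [Multiset.countP_eq_zero] at h0
      have h1 : (s'.map wt).prod.2 = 1 := by
        refine (Multiset.prod_hom (s'.map wt) (MonoidHom.snd (ℤˣ × ℤˣ) ℤˣ)).symm.trans ?_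
        rw [Multiset.map_map]
        refine Multiset.prod_eq_one fun x hx => ?_
        obtain ⟨g, hg, rfl⟩ := Multiset.mem_map.1 hx
        have hg1 := hdeg g (Multiset.mem_cons_of_mem hg)
        have hg2 := h0 g hg
        cases g with
        | lin => simp [deg] at hg1
        | quad e e' p p' ψ =>
          obtain rfl : e = e' := not_not.1 hg2
          exact Int.units_mul_self _
      have h2 := congrArg Prod.snd hw
      rw [Multiset.map_cons, Multiset.prod_cons, Prod.snd_mul, h1, mul_one] at h2
      cases m with
      | lin => exact hmm
      | quad e e' p p' ψ =>
        have h3 : e * e' = 1 := h2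
        exact hmm (by rw [mul_eq_one_iff_eq_inv, Int.units_inv_eq_self] at h3; exact h3)
    · push Not at hmx
      obtain ⟨u, hus, hu⟩ := exists_le_of_le_card s (n := 3) (by omega)
      obtain ⟨t, hts, ht0, ht⟩ := exists_le_of_unmixed u hu.ge fun x hx =>
        ⟨hdeg x (Multiset.mem_of_le hus hx), hmx x (Multiset.mem_of_le hus hx)⟩
      have h1 := Multiset.card_le_card hts
      rw [hmin t (hts.trans hus) ht0 ht] at h1
      omega

end Gen

end Upper

section Upper

variable {K ι : Type*} [Field K] [Fintype ι] [DecidableEq ι]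
  {ρ : Representation K Q8C2 (ι → K)} {ω : K}

/-! ### Decomposition of the coordinate ring -/

theorem mem_of_add_mem_of_sub_mem {K ι : Type*} [Field K] (h2 : (2 : K) ≠ 0)
    (S : Submodule K (MvPolynomial ι K)) {f g : MvPolynomial ι K} (h₁ : f + g ∈ S) (h₂ : f - g ∈ S) :
    f ∈ S := by
  have h : f = (2⁻¹ : K) • ((f + g) + (f - g)) := by
    rw [show (f + g) + (f - g) = (2 : K) • f by rw [two_smul]; ring, smul_smul,
      inv_mul_cancel₀ h2, one_smul]
  rw [h]
  exact S.smul_mem _ (S.add_mem h₁ h₂)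

variable (ρ ω) in
/-- The span of the linear weight vectors. -/
noncomputable def linSpan : Submodule K (MvPolynomial ι K) :=
  Submodule.span K {t | t.totalDegree ≤ 1 ∧ ∃ χ, HasWeight ρ t χ}

variable (ρ ω) in
/-- The span of the coordinate pairs on which `C₂` acts by `e`. -/
noncomputable def pairSpan (e : ℤˣ) : Submodule K (MvPolynomial ι K) :=
  Submodule.span K {f | ∃ p : CoordPair ρ ω e, f = p.x ∨ f = p.y}

variable (ρ ω) in
/-- The span of the quadratic weight vectors with prescribed signs of `C₂` on their two coordinate
pairs. -/
noncomputable def quadSpan (e e' : ℤˣ) : Submodule K (MvPolynomial ι K) :=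
  Submodule.span K {f | ∃ (p : CoordPair ρ ω e) (p' : CoordPair ρ ω e') (ψ : ℤˣ × ℤˣ),
    f = p.bil p' ψ}

variable (ρ ω) in
/-- The span of all products of linear and unmixed quadratic weight vectors. -/
noncomputable def unmixedSpan : Submodule K (MvPolynomial ι K) :=
  Submodule.span K {f | ∃ s : Multiset (Gen ρ ω), (∀ g ∈ s, ¬ g.Mixed) ∧ f = (s.map Gen.val).prod}

theorem pairSpan_mul_pairSpan_le (h2 : (2 : K) ≠ 0) (e e' : ℤˣ) :
    pairSpan ρ ω e * pairSpan ρ ω e' ≤ quadSpan ρ ω e e' := by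
  unfold pairSpan
  rw [Submodule.span_mul_span, Submodule.span_le]
  rintro _ ⟨f, ⟨p, hf⟩, f', ⟨p', hf'⟩, rfl⟩
  have hq : ∀ ψ, p.bil p' ψ ∈ quadSpan ρ ω e e' := fun ψ => Submodule.subset_span ⟨p, p', ψ, rfl⟩
  have h1 := hq (1, 1)
  have h2' := hq (1, -1)
  have h3 := hq (-1, 1)
  have h4 := hq (-1, -1)
  simp only [CoordPair.bil, bil, if_true, Units.val_one, Int.cast_one, one_mul, Units.val_neg,
    Int.cast_neg, neg_mul, sub_neg_eq_add, reduceIte, show (-1 : ℤˣ) ≠ 1 by decide,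
    ← sub_eq_add_neg] at h1 h2' h3 h4
  rcases hf with rfl | rfl <;> rcases hf' with rfl | rfl
  · exact mem_of_add_mem_of_sub_mem h2 _ h3 h4
  · exact mem_of_add_mem_of_sub_mem h2 _ h2' h1
  · refine mem_of_add_mem_of_sub_mem h2 _ (g := p.x * p'.y) ?_ ?_
    · rw [add_comm]; exact h2'
    · rw [← neg_sub]; exact neg_mem h1
  · refine mem_of_add_mem_of_sub_mem h2 _ (g := p.x * p'.x) ?_ ?_
    · rw [add_comm]; exact h3
    · rw [← neg_sub]; exact neg_mem h4

theorem one_le_unmixedSpan : 1 ≤ unmixedSpan ρ ω :=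
  Submodule.one_le.2 (Submodule.subset_span ⟨0, by simp, by simp⟩)

theorem unmixedSpan_mul_self : unmixedSpan ρ ω * unmixedSpan ρ ω ≤ unmixedSpan ρ ω := by
  unfold unmixedSpan
  rw [Submodule.span_mul_span, Submodule.span_le]
  rintro _ ⟨_, ⟨s, hs, rfl⟩, _, ⟨s', hs', rfl⟩, rfl⟩
  refine Submodule.subset_span ⟨s + s', fun g hg => ?_, by simp⟩
  exact (Multiset.mem_add.1 hg).elim (hs g) (hs' g)

theorem linSpan_le_unmixedSpan : linSpan ρ ≤ unmixedSpan ρ ω := by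
  refine Submodule.span_le.2 ?_
  rintro t ⟨hd, χ, hw⟩
  exact Submodule.subset_span ⟨{Gen.lin t χ hd hw}, by simp [Gen.Mixed], by simp [Gen.val]⟩

theorem quadSpan_le_unmixedSpan (e : ℤˣ) : quadSpan ρ ω e e ≤ unmixedSpan ρ ω := by
  refine Submodule.span_le.2 ?_
  rintro _ ⟨p, p', ψ, rfl⟩
  exact Submodule.subset_span ⟨{Gen.quad e e p p' ψ}, by simp [Gen.Mixed], by simp [Gen.val]⟩

/-- An operator of order two on a linear form splits it into eigenvectors. -/
theorem coordAct_add_sub {g : Q8C2} {f : MvPolynomial ι K}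
    (hg : coordAct ρ g (coordAct ρ g f) = f) :
    coordAct ρ g (f + coordAct ρ g f) = ((1 : ℤˣ) : ℤ) * (f + coordAct ρ g f) ∧
    coordAct ρ g (f - coordAct ρ g f) = ((-1 : ℤˣ) : ℤ) * (f - coordAct ρ g f) := by
  constructor <;> simp [hg, add_comm]

/-- To prove a property of linear forms on which the involution `g` acts, it suffices to
prove it for eigenvectors. -/
theorem mem_of_forall_eigenvector (h2 : (2 : K) ≠ 0) (S : Submodule K (MvPolynomial ι K))
    (Q : MvPolynomial ι K → Prop) {g : Q8C2} {f : MvPolynomial ι K}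
    (hg : coordAct ρ g (coordAct ρ g f) = f)
    (hadd : Q (f + coordAct ρ g f)) (hsub : Q (f - coordAct ρ g f))
    (h : ∀ f', Q f' → ∀ ε : ℤˣ, coordAct ρ g f' = ((ε : ℤ) : MvPolynomial ι K) * f' → f' ∈ S) :
    f ∈ S :=
  mem_of_add_mem_of_sub_mem h2 S (h _ hadd 1 (coordAct_add_sub hg).1)
    (h _ hsub (-1) (coordAct_add_sub hg).2)

theorem totalDegree_add_sub_coordAct_le {f : MvPolynomial ι K} (g : Q8C2)
    (hf : f.totalDegree ≤ 1) : (f + coordAct ρ g f).totalDegree ≤ 1 ∧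
      (f - coordAct ρ g f).totalDegree ≤ 1 :=
  have h := (totalDegree_coordAct_le ρ g f).trans hf
  ⟨(totalDegree_add _ _).trans (max_le hf h), (totalDegree_sub _ _).trans (max_le hf h)⟩

/-- The forms fixed by the central involution of `Dic₈` are combinations of weight vectors. -/
theorem mem_linSpan (h2 : (2 : K) ≠ 0) {f : MvPolynomial ι K} (hd : f.totalDegree ≤ 1)
    (hz : coordAct ρ (gI * gI) f = f) : f ∈ linSpan ρ := by
  have hcomm : ∀ (g h : Q8C2) (f : MvPolynomial ι K), g * h = h * g →
      coordAct ρ g (coordAct ρ h f) = coordAct ρ h (coordAct ρ g f) := fun g h f e => by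
    rw [← coordAct_mul, e, coordAct_mul]
  have hcast : ∀ (g h : Q8C2) (f : MvPolynomial ι K) (ε : ℤˣ),
      coordAct ρ g f = ((ε : ℤ) : MvPolynomial ι K) * f →
      coordAct ρ g (coordAct ρ h f) = coordAct ρ h (coordAct ρ g f) →
      coordAct ρ g (f + coordAct ρ h f) = ((ε : ℤ) : MvPolynomial ι K) * (f + coordAct ρ h f) ∧
      coordAct ρ g (f - coordAct ρ h f) =
        ((ε : ℤ) : MvPolynomial ι K) * (f - coordAct ρ h f) := by
    intro g h f ε h1 h2
    rw [map_add, map_sub, h2, h1, map_mul, map_intCast]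
    constructor <;> ring
  -- On forms fixed by `i² = j²` the operators `i` and `j` are commuting involutions.
  have hji : ∀ f : MvPolynomial ι K, coordAct ρ (gI * gI) f = f →
      coordAct ρ gI (coordAct ρ gJ f) = coordAct ρ gJ (coordAct ρ gI f) := fun f hf => by
    rw [← coordAct_mul, show gI * gJ = gJ * gI * (gI * gI) by decide, coordAct_mul, hf,
      coordAct_mul]
  have hzz : ∀ (g : Q8C2) (f : MvPolynomial ι K), coordAct ρ (gI * gI) f = f →
      coordAct ρ (gI * gI) (f + coordAct ρ g f) = f + coordAct ρ g f ∧
      coordAct ρ (gI * gI) (f - coordAct ρ g f) = f - coordAct ρ g f := fun g f hf => by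
    have : gI * gI * g = g * (gI * gI) := by revert g; decide
    rw [map_add, map_sub, hcomm _ _ _ this, hf]
    exact ⟨rfl, rfl⟩
  refine mem_of_forall_eigenvector (ρ := ρ) h2 _
    (fun f => f.totalDegree ≤ 1 ∧ coordAct ρ (gI * gI) f = f)
    (g := gI) (by rw [← coordAct_mul, hz])
    ⟨(totalDegree_add_sub_coordAct_le _ hd).1, (hzz _ _ hz).1⟩
    ⟨(totalDegree_add_sub_coordAct_le _ hd).2, (hzz _ _ hz).2⟩ ?_
  clear! f
  rintro f ⟨hd, hz⟩ ε hε
  refine mem_of_forall_eigenvector (ρ := ρ) h2 _ (fun f => f.totalDegree ≤ 1 ∧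
    coordAct ρ gI f = ((ε : ℤ) : MvPolynomial ι K) * f)
    (g := gJ) (by rw [← coordAct_mul, show gJ * gJ = gI * gI by decide, hz])
    ⟨(totalDegree_add_sub_coordAct_le _ hd).1, (hcast _ _ _ _ hε (hji _ hz)).1⟩
    ⟨(totalDegree_add_sub_coordAct_le _ hd).2, (hcast _ _ _ _ hε (hji _ hz)).2⟩ ?_
  clear! f
  rintro f ⟨hd, hε⟩ η hη
  have hIC : ∀ f : MvPolynomial ι K, coordAct ρ gI (coordAct ρ gC f) =
    coordAct ρ gC (coordAct ρ gI f) := fun f => hcomm _ _ _ (by decide)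
  have hJC : ∀ f : MvPolynomial ι K, coordAct ρ gJ (coordAct ρ gC f) =
    coordAct ρ gC (coordAct ρ gJ f) := fun f => hcomm _ _ _ (by decide)
  refine mem_of_forall_eigenvector (ρ := ρ) h2 _ (fun f => f.totalDegree ≤ 1 ∧
    coordAct ρ gI f = ((ε : ℤ) : MvPolynomial ι K) * f ∧
    coordAct ρ gJ f = ((η : ℤ) : MvPolynomial ι K) * f)
    (g := gC) (by rw [← coordAct_mul, show gC * gC = 1 by decide, coordAct_one])
    ⟨(totalDegree_add_sub_coordAct_le _ hd).1, (hcast _ _ _ _ hε (hIC _)).1,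
      (hcast _ _ _ _ hη (hJC _)).1⟩
    ⟨(totalDegree_add_sub_coordAct_le _ hd).2, (hcast _ _ _ _ hε (hIC _)).2,
      (hcast _ _ _ _ hη (hJC _)).2⟩ ?_
  clear! f
  rintro f ⟨hd, hε, hη⟩ δ hδ
  exact Submodule.subset_span ⟨hd, ((ε, η), δ), hε, hη, hδ⟩

/-- The forms on which the central involution of `Dic₈` acts as `-1` are combinations of
coordinate pairs. -/
theorem mem_pairSpan (h2 : (2 : K) ≠ 0) (hω : ω ^ 2 = -1) {f : MvPolynomial ι K}
    (hd : f.totalDegree ≤ 1) (hz : coordAct ρ (gI * gI) f = -f) :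
    f ∈ pairSpan ρ ω 1 ⊔ pairSpan ρ ω (-1) := by
  have hle : ∀ e : ℤˣ, pairSpan ρ ω e ≤ pairSpan ρ ω 1 ⊔ pairSpan ρ ω (-1) := fun e => by
    rcases Int.units_eq_one_or e with rfl | rfl
    · exact le_sup_left
    · exact le_sup_right
  have hC : (C ω : MvPolynomial ι K) * C ω = -1 := by
    rw [← C_mul, ← sq, hω]; simp
  have hzC : coordAct ρ (gI * gI) (coordAct ρ gC f) = -coordAct ρ gC f := by
    rw [← coordAct_mul, show gI * gI * gC = gC * (gI * gI) by decide, coordAct_mul, hz, map_neg]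
  refine mem_of_forall_eigenvector (ρ := ρ) h2 _
    (fun f => f.totalDegree ≤ 1 ∧ coordAct ρ (gI * gI) f = -f)
    (g := gC) (by rw [← coordAct_mul, show gC * gC = 1 by decide, coordAct_one])
    ⟨(totalDegree_add_sub_coordAct_le _ hd).1, by rw [map_add, hz, hzC]; ring⟩
    ⟨(totalDegree_add_sub_coordAct_le _ hd).2, by rw [map_sub, hz, hzC]; ring⟩ ?_
  clear! f
  rintro f ⟨hd, hz⟩ e he
  refine hle e ?_
  have hii : coordAct ρ gI (coordAct ρ gI f) = -f := by rw [← coordAct_mul, hz]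
  have hdi := (totalDegree_coordAct_le ρ gI f).trans hd
  have hdC : (C ω * coordAct ρ gI f).totalDegree ≤ 1 :=
    (totalDegree_mul _ _).trans (by simpa using hdi)
  have hc : coordAct ρ gC (C ω * coordAct ρ gI f) =
      ((e : ℤ) : MvPolynomial ι K) * (C ω * coordAct ρ gI f) := by
    rw [map_mul, algHom_C, algebraMap_eq, ← coordAct_mul, show gC * gI = gI * gC by decide,
      coordAct_mul, he, map_mul, map_intCast]
    ring
  -- `f` is half the sum of the `i`-eigenvectors `f + ω i f` and `f - ω i f`, with eigenvalues
  -- `-ω` and `ω`.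
  refine mem_of_add_mem_of_sub_mem h2 _ (g := C ω * coordAct ρ gI f) ?_ ?_
  · -- An eigenvector `x` with eigenvalue `-ω` is the second member of the pair `(-j x, x)`.
    set x := f + C ω * coordAct ρ gI f with hx
    have hxd : x.totalDegree ≤ 1 := (totalDegree_add _ _).trans (max_le hd hdC)
    have hix : coordAct ρ gI x = -(C ω * x) := by
      simp only [hx, map_add, map_mul, algHom_C, algebraMap_eq, hii]
      linear_combination (coordAct ρ gI f) * hC
    have hcx : coordAct ρ gC x = ((e : ℤ) : MvPolynomial ι K) * x := by
      rw [hx, map_add, he, hc]; ring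
    have hiix : coordAct ρ (gI * gI) x = -x := by
      rw [coordAct_mul, hix, map_neg, map_mul, algHom_C, algebraMap_eq, hix]
      linear_combination x * hC
    have hjjx : coordAct ρ gJ (coordAct ρ gJ x) = -x := by
      rw [← coordAct_mul, show gJ * gJ = gI * gI by decide, hiix]
    let p : CoordPair ρ ω e := CoordPair.ofEigenvector hω (coordAct ρ gJ x)
      ((totalDegree_coordAct_le ρ gJ x).trans hxd)
      (by
        rw [← coordAct_mul, show gI * gJ = gJ * gI * (gI * gI) by decide, coordAct_mul, hiix,
          map_neg, coordAct_mul, hix, map_neg, map_mul, algHom_C, algebraMap_eq, neg_neg])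
      (by
        rw [← coordAct_mul, show gC * gJ = gJ * gC by decide, coordAct_mul, hcx, map_mul,
          map_intCast])
    have hy : p.y = -x := hjjx
    have : -p.y ∈ pairSpan ρ ω e := neg_mem (Submodule.subset_span ⟨p, Or.inr rfl⟩)
    rwa [hy, neg_neg] at this
  · set x := f - C ω * coordAct ρ gI f with hx
    have hxd : x.totalDegree ≤ 1 := (totalDegree_sub _ _).trans (max_le hd hdC)
    have hix : coordAct ρ gI x = C ω * x := by
      simp only [hx, map_sub, map_mul, algHom_C, algebraMap_eq, hii]
      linear_combination (coordAct ρ gI f) * hC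
    have hcx : coordAct ρ gC x = ((e : ℤ) : MvPolynomial ι K) * x := by
      rw [hx, map_sub, he, hc]; ring
    exact Submodule.subset_span ⟨CoordPair.ofEigenvector hω x hxd hix hcx, Or.inl rfl⟩

theorem X_mem (h2 : (2 : K) ≠ 0) (hω : ω ^ 2 = -1) (k : ι) :
    (X k : MvPolynomial ι K) ∈ unmixedSpan ρ ω ⊔ (pairSpan ρ ω 1 ⊔ pairSpan ρ ω (-1)) := by
  have hd : (X k : MvPolynomial ι K).totalDegree ≤ 1 := by simp
  have hzz : ∀ f : MvPolynomial ι K, coordAct ρ (gI * gI) (coordAct ρ (gI * gI) f) = f :=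
    fun f => by
      rw [← coordAct_mul, show gI * gI * (gI * gI) = 1 by decide, coordAct_one]
  refine mem_of_add_mem_of_sub_mem h2 _ (g := coordAct ρ (gI * gI) (X k)) ?_ ?_
  · refine Submodule.mem_sup_left (linSpan_le_unmixedSpan (mem_linSpan h2
      (totalDegree_add_sub_coordAct_le _ hd).1 ?_))
    rw [map_add, hzz, add_comm]
  · refine Submodule.mem_sup_right (mem_pairSpan h2 hω
      (totalDegree_add_sub_coordAct_le _ hd).2 ?_)
    rw [map_sub, hzz, neg_sub]

/-- Every polynomial is a combination of products of linear and unmixed quadratic weight vectors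
with at most one coordinate of each sign. -/
theorem mem_unmixedSpan_mul (h2 : (2 : K) ≠ 0) (hω : ω ^ 2 = -1) (f : MvPolynomial ι K) :
    f ∈ unmixedSpan ρ ω * (1 + pairSpan ρ ω 1) * (1 + pairSpan ρ ω (-1)) := by
  set P := unmixedSpan ρ ω
  set A := pairSpan ρ ω 1
  set B := pairSpan ρ ω (-1)
  have hPP : P * P ≤ P := unmixedSpan_mul_self
  have hA : A * A ≤ P := (pairSpan_mul_pairSpan_le h2 1 1).trans (quadSpan_le_unmixedSpan 1)
  have hB : B * B ≤ P :=
    (pairSpan_mul_pairSpan_le h2 (-1) (-1)).trans (quadSpan_le_unmixedSpan (-1))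
  have h1 : 1 ≤ P := one_le_unmixedSpan
  have hstep : ∀ D : Submodule K (MvPolynomial ι K), D * D ≤ P → P * (1 + D) * D ≤ P * (1 + D) := by
    intro D hD
    rw [mul_assoc, add_mul, one_mul, mul_add, mul_add, mul_one, add_comm]
    exact add_le_add ((mul_le_mul_right hD P).trans hPP) le_rfl
  have h : P * (1 + A) * (1 + B) * (P + (A + B)) ≤ P * (1 + A) * (1 + B) := by
    rw [mul_add (P * (1 + A) * (1 + B)) P, mul_add (P * (1 + A) * (1 + B)) A]
    refine sup_le ?_ (sup_le ?_ ?_)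
    · rw [show P * (1 + A) * (1 + B) * P = P * P * ((1 + A) * (1 + B)) by ring, mul_assoc P (1 + A)]
      exact mul_le_mul_left hPP _
    · rw [show P * (1 + A) * (1 + B) * A = P * (1 + A) * A * (1 + B) by ring]
      exact mul_le_mul_left (hstep A hA) _
    · rw [show P * (1 + A) * (1 + B) * B = P * (1 + B) * B * (1 + A) by ring,
        show P * (1 + A) * (1 + B) = P * (1 + B) * (1 + A) by ring]
      exact mul_le_mul_left (hstep B hB) _
  have hone : (1 : MvPolynomial ι K) ∈ P * (1 + A) * (1 + B) := by
    have h1D : ∀ D : Submodule K (MvPolynomial ι K), 1 ∈ 1 + D := fun D =>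
      Submodule.mem_sup_left (Submodule.one_le.1 le_rfl)
    have := Submodule.mul_mem_mul (Submodule.mul_mem_mul (Submodule.one_le.1 h1) (h1D A)) (h1D B)
    rwa [one_mul, one_mul] at this
  induction f using MvPolynomial.induction_on with
  | C a => rw [← mul_one (C a), ← smul_eq_C_mul]; exact Submodule.smul_mem _ _ hone
  | add f g hf hg => exact add_mem hf hg
  | mul_X f k hf => exact h (Submodule.mul_mem_mul hf (X_mem h2 hω k))

/-- Criterion for a subalgebra to contain all invariants. -/
theorem polyInvariants_le (h2 : (2 : K) ≠ 0) (hω : ω ^ 2 = -1) (P : Subalgebra K (MvPolynomial ι K))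
    (h6 : ∀ f ∈ polyInvariantsLE ρ 6, f ∈ P)
    (h7 : ∀ (t : MvPolynomial ι K) (χ : (ℤˣ × ℤˣ) × ℤˣ), t.totalDegree ≤ 1 → HasWeight ρ t χ →
      ∀ (e₁ e₂ e e' : ℤˣ) (p₁ p₁' : CoordPair ρ ω e₁) (p₂ p₂' : CoordPair ρ ω e₂)
        (p : CoordPair ρ ω e) (p' : CoordPair ρ ω e') (a b ψ : ℤˣ × ℤˣ), e ≠ e' → a ≠ 1 → b ≠ 1 →
        a ≠ b → χ * ((a, 1) * ((b, 1) * (ψ, e * e'))) = 1 →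
        t * (p₁.bil p₁' a * (p₂.bil p₂' b * p.bil p' ψ)) ∈ P) :
    polyInvariants ρ ≤ P := by
  -- The Reynolds operator, up to the factor `16`.
  let R : MvPolynomial ι K →ₗ[K] MvPolynomial ι K := ∑ g, (coordAct ρ g).toLinearMap
  have hR : ∀ f, R f = ∑ g, coordAct ρ g f := fun f => by simp [R]
  have hprod : ∀ s : Multiset (Gen ρ ω), s.countP Gen.Mixed ≤ 1 →
      R (s.map Gen.val).prod ∈ P := by
    intro s hs
    have hw := Gen.hasWeight_prod hω s
    rw [hR]
    by_cases h : (s.map Gen.wt).prod = 1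
    · rw [Finset.sum_congr rfl fun g _ => mem_polyInvariants.1
        (HasWeight.mem_polyInvariants (h ▸ hw)) g]
      exact sum_mem fun _ _ => Gen.prod_mem hω P h6 h7 s hs h
    · rw [hw.sum_coordAct h2 h]
      exact zero_mem _
  have hunmixed : ∀ s : Multiset (Gen ρ ω), (∀ g ∈ s, ¬ g.Mixed) → s.countP Gen.Mixed = 0 :=
    fun s hs => Multiset.countP_eq_zero.2 hs
  -- Products with a single coordinate are negated by the central involution of `Dic₈`.
  have hpair : ∀ e : ℤˣ, unmixedSpan ρ ω * pairSpan ρ ω e ≤ P.toSubmodule.comap R := by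
    intro e
    unfold unmixedSpan pairSpan
    rw [Submodule.span_mul_span, Submodule.span_le]
    rintro _ ⟨_, ⟨s, hs, rfl⟩, f, ⟨p, hf⟩, rfl⟩
    have hC : (C ω : MvPolynomial ι K) * C ω = -1 := by
      rw [← C_mul, ← sq, hω]; simp
    have h1 : coordAct ρ (gI * gI) f = -f := by
      rw [coordAct_mul]
      rcases hf with rfl | rfl
      · rw [p.act_i_x, map_mul, algHom_C, algebraMap_eq, p.act_i_x]
        linear_combination p.x * hC
      · rw [p.act_i_y, map_neg, map_mul, algHom_C, algebraMap_eq, p.act_i_y]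
        linear_combination p.y * hC
    have h3 : coordAct ρ (gI * gI) (s.map Gen.val).prod = (s.map Gen.val).prod := by
      have h := (Gen.hasWeight_prod hω s).1
      rw [coordAct_mul, h, map_mul, map_intCast, h, ← mul_assoc, ← Int.cast_mul,
        Int.units_coe_mul_self, Int.cast_one, one_mul]
    have h4 : R ((s.map Gen.val).prod * f) = 0 := by
      rw [hR]
      exact sum_coordAct_eq_zero h2 ρ (gI * gI) (by rw [map_mul, h1, h3, mul_neg])
    change R ((s.map Gen.val).prod * f) ∈ P
    rw [h4]
    exact zero_mem _
  have hmixed : unmixedSpan ρ ω * quadSpan ρ ω 1 (-1) ≤ P.toSubmodule.comap R := by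
    unfold unmixedSpan quadSpan
    rw [Submodule.span_mul_span, Submodule.span_le]
    rintro _ ⟨_, ⟨s, hs, rfl⟩, _, ⟨p, p', ψ, rfl⟩, rfl⟩
    have := hprod (Gen.quad 1 (-1) p p' ψ ::ₘ s)
      ((Multiset.countP_cons _ _ _).trans_le (by rw [hunmixed s hs]; split_ifs <;> simp))
    rw [Multiset.map_cons, Multiset.prod_cons, mul_comm] at this
    exact this
  have hplain : unmixedSpan ρ ω ≤ P.toSubmodule.comap R := by
    refine Submodule.span_le.2 ?_
    rintro _ ⟨s, hs, rfl⟩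
    exact hprod s (by rw [hunmixed s hs]; exact zero_le_one)
  have hall : unmixedSpan ρ ω * (1 + pairSpan ρ ω 1) * (1 + pairSpan ρ ω (-1)) ≤
      P.toSubmodule.comap R := by
    rw [mul_add, mul_add, mul_one, mul_one, add_mul, mul_assoc]
    exact sup_le (sup_le hplain (hpair 1)) (sup_le (hpair (-1))
      ((mul_le_mul_right (pairSpan_mul_pairSpan_le h2 1 (-1)) _).trans hmixed))
  intro f hf
  have h := hall (mem_unmixedSpan_mul h2 hω f)
  have h' : R f ∈ P := h
  have h16 : (Fintype.card Q8C2 : K) ≠ 0 := by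
    rw [show Fintype.card Q8C2 = 2 ^ 4 by decide, Nat.cast_pow]
    exact pow_ne_zero _ (by exact_mod_cast h2)
  rw [hR, Finset.sum_congr rfl fun g _ => mem_polyInvariants.1 hf g, Finset.sum_const,
    Finset.card_univ, ← Nat.cast_smul_eq_nsmul K] at h'
  have := P.smul_mem h' (Fintype.card Q8C2 : K)⁻¹
  rwa [smul_smul, inv_mul_cancel₀ h16, one_smul] at this

end Upper

/-! ### The upper bounds -/

theorem noetherNumberOf_le {K ι : Type*} [Field K] [Fintype ι] [DecidableEq ι]
    (h2 : (2 : K) ≠ 0) {ω : K} (hω : ω ^ 2 = -1) (ρ : Representation K Q8C2 (ι → K)) :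
    noetherNumberOf ρ ≤ 7 := by
  suffices h : Algebra.adjoin K (polyInvariantsLE ρ 7) = polyInvariants ρ from
    iInf₂_le (7 : ℕ) h
  refine le_antisymm (Algebra.adjoin_le fun f hf => hf.1) ?_
  refine polyInvariants_le h2 hω _
    (fun f hf => Algebra.subset_adjoin ⟨hf.1, hf.2.trans (by norm_num)⟩) ?_
  intro t χ htd htw e₁ e₂ e e' p₁ p₁' p₂ p₂' p p' a b ψ _ _ _ _ hχ
  refine Algebra.subset_adjoin ⟨HasWeight.mem_polyInvariants ?_, ?_⟩
  · have := htw.mul ((p₁.hasWeight_bil hω p₁' a).mul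
      ((p₂.hasWeight_bil hω p₂' b).mul (p.hasWeight_bil hω p' ψ)))
    rwa [Int.units_mul_self e₁, Int.units_mul_self e₂, hχ] at this
  · exact totalDegree_mul_le_of_le htd (totalDegree_mul_le_of_le (p₁.totalDegree_bil_le p₁' a)
      (totalDegree_mul_le_of_le (p₂.totalDegree_bil_le p₂' b) (p.totalDegree_bil_le p' ψ)))

theorem klein_four_cases (a b c : ℤˣ × ℤˣ) (ha : a ≠ 1) (hb : b ≠ 1) (hab : a ≠ b)
    (hc : c ≠ 1) : c = a ∨ c = b ∨ c = a * b := by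
  revert a b c; decide

/-- Two points not distinguished by invariants of degree at most `6` are not distinguished by
`t * q₁ * q₂ * q` either, where `t` is linear, `q₁` and `q₂` are unmixed quadratic and `q` is mixed
quadratic. If `q` does not vanish at `v`, neither does the form `q'` with another label on the same
coordinate pairs. Depending on its label, `t * q₁ * q₂ * q * q' ^ 2` is one of
`(t * q₂ * q') * (q₁ * q' * q)`, `(t * q₁ * q') * (q₂ * q' * q)` and
`(t * q') * (q₁ * q₂ * q * q')`, whose factors are built from invariants of degree at most `6`. -/
theorem eval_eq_eval_of_mixed {K ι : Type*} [Field K] [Fintype ι] [DecidableEq ι]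
    (h2 : (2 : K) ≠ 0) {ω : K} (hω : ω ^ 2 = -1) {ρ : Representation K Q8C2 (ι → K)} {v w : ι → K}
    (h : ∀ f ∈ polyInvariantsLE ρ 6, eval v f = eval w f)
    (t : MvPolynomial ι K) (χ : (ℤˣ × ℤˣ) × ℤˣ) (htd : t.totalDegree ≤ 1) (htw : HasWeight ρ t χ)
    {e₁ e₂ e e' : ℤˣ} (p₁ p₁' : CoordPair ρ ω e₁) (p₂ p₂' : CoordPair ρ ω e₂)
    (p : CoordPair ρ ω e) (p' : CoordPair ρ ω e') (a b ψ : ℤˣ × ℤˣ) (ha : a ≠ 1) (hb : b ≠ 1)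
    (hab : a ≠ b) (hχ : χ * ((a, 1) * ((b, 1) * (ψ, e * e'))) = 1) :
    eval v (t * (p₁.bil p₁' a * (p₂.bil p₂' b * p.bil p' ψ))) =
      eval w (t * (p₁.bil p₁' a * (p₂.bil p₂' b * p.bil p' ψ))) := by
  have agree : ∀ (f : MvPolynomial ι K) (θ : (ℤˣ × ℤˣ) × ℤˣ), HasWeight ρ f θ → θ = 1 →
      f.totalDegree ≤ 6 → eval v f = eval w f := by
    rintro f _ hw rfl hd
    exact h f ⟨hw.mem_polyInvariants, hd⟩
  have bilw : ∀ {e e' : ℤˣ} (p : CoordPair ρ ω e) (p' : CoordPair ρ ω e') (ψ : ℤˣ × ℤˣ),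
      HasWeight ρ (p.bil p' ψ) (ψ, e * e') := fun p p' ψ => p.hasWeight_bil hω p' ψ
  have purew : ∀ {e : ℤˣ} (p p' : CoordPair ρ ω e) (ψ : ℤˣ × ℤˣ),
      HasWeight ρ (p.bil p' ψ) (ψ, 1) := fun {e} p p' ψ => Int.units_mul_self e ▸ bilw p p' ψ
  have bild : ∀ {e e' : ℤˣ} (p : CoordPair ρ ω e) (p' : CoordPair ρ ω e') (ψ : ℤˣ × ℤˣ),
      (p.bil p' ψ).totalDegree ≤ 2 := fun p p' ψ => p.totalDegree_bil_le p' ψ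
  have hsq : ∀ θ : ℤˣ × ℤˣ, θ * θ = 1 := by decide
  have hsqδ : ∀ δ : ℤˣ, δ * δ = 1 := Int.units_mul_self
  have agree_sq : ∀ ψ : ℤˣ × ℤˣ, eval v (p.bil p' ψ * p.bil p' ψ) =
      eval w (p.bil p' ψ * p.bil p' ψ) := fun ψ =>
    agree _ _ ((bilw p p' ψ).mul (bilw p p' ψ)) (Prod.ext (hsq _) (hsqδ _))
      ((totalDegree_mul_le_of_le (bild _ _ _) (bild _ _ _)).trans (by norm_num))
  -- The first two labels of `q'` are handled by the same computation.
  have key : ∀ T Q₁ Q₂ Q Q' : MvPolynomial ι K, eval v Q' ≠ 0 →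
      eval v (Q' * Q') = eval w (Q' * Q') →
      eval v (T * (Q₂ * Q')) = eval w (T * (Q₂ * Q')) →
      eval v (Q₁ * (Q' * Q)) = eval w (Q₁ * (Q' * Q)) →
      eval v (T * (Q₁ * (Q₂ * Q))) = eval w (T * (Q₁ * (Q₂ * Q))) := by
    intro T Q₁ Q₂ Q Q' h0 h1 h3 h4
    refine mul_right_cancel₀ (b := eval v (Q' * Q')) (by simpa using h0) ?_
    nth_rw 2 [h1]
    simp only [map_mul] at h3 h4 ⊢
    linear_combination (eval v Q₁ * (eval v Q' * eval v Q)) * h3 +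
      (eval w T * (eval w Q₂ * eval w Q')) * h4
  by_cases hq : eval v (p.bil p' ψ) = 0
  · have hq' : eval w (p.bil p' ψ) = 0 := by
      have := agree_sq ψ
      rw [map_mul, map_mul, hq, zero_mul] at this
      exact mul_self_eq_zero.1 this.symm
    simp only [map_mul, hq, hq', mul_zero]
  have evalbil : ∀ ψ, eval v (p.bil p' ψ) =
      bil ψ (eval v p.x) (eval v p.y) (eval v p'.x) (eval v p'.y) :=
    fun ψ => map_bil (eval v) ψ _ _ _ _
  obtain ⟨ψ', hne, hψ'⟩ := exists_ne_bil_ne_zero ψ _ _ _ _ (evalbil ψ ▸ hq)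
  rw [← evalbil] at hψ'
  have hc1 : ψ * ψ' ≠ 1 := fun hc => hne (mul_left_cancel (hc.trans (hsq ψ).symm))
  have hψc : ∀ c, ψ * ψ' = c → ψ' = ψ * c := fun c hc => by
    rw [← hc, ← mul_assoc, hsq, one_mul]
  rcases klein_four_cases a b _ ha hb hab hc1 with hc | hc | hc
  · refine key t _ _ _ (p.bil p' ψ') hψ' (agree_sq ψ') ?_ ?_
    · refine agree _ _ (htw.mul ((purew p₂ p₂' b).mul (bilw p p' ψ'))) ?_
        ((totalDegree_mul_le_of_le htd (totalDegree_mul_le_of_le (bild _ _ _) (bild _ _ _))).trans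
          (by norm_num))
      rw [← hχ, hψc a hc]
      congr 1
      ext <;> simp [mul_comm, mul_left_comm]
    · refine agree _ _ ((purew p₁ p₁' a).mul ((bilw p p' ψ').mul (bilw p p' ψ))) ?_
        (totalDegree_mul_le_of_le (bild _ _ _) (totalDegree_mul_le_of_le (bild _ _ _) (bild _ _ _)))
      refine Prod.ext ?_ (by simp [hsqδ])
      change a * (ψ' * ψ) = 1
      rw [mul_comm ψ', hc, hsq]
  · rw [mul_left_comm (p₁.bil p₁' a)]
    refine key t _ _ _ (p.bil p' ψ') hψ' (agree_sq ψ') ?_ ?_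
    · refine agree _ _ (htw.mul ((purew p₁ p₁' a).mul (bilw p p' ψ'))) ?_
        ((totalDegree_mul_le_of_le htd (totalDegree_mul_le_of_le (bild _ _ _) (bild _ _ _))).trans
          (by norm_num))
      rw [← hχ, hψc b hc]
      congr 1
      ext <;> simp [mul_comm]
    · refine agree _ _ ((purew p₂ p₂' b).mul ((bilw p p' ψ').mul (bilw p p' ψ))) ?_
        (totalDegree_mul_le_of_le (bild _ _ _) (totalDegree_mul_le_of_le (bild _ _ _) (bild _ _ _)))
      refine Prod.ext ?_ (by simp [hsqδ])
      change b * (ψ' * ψ) = 1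
      rw [mul_comm ψ', hc, hsq]
  · have ht : eval v (t * p.bil p' ψ') = eval w (t * p.bil p' ψ') := by
      refine agree _ _ (htw.mul (bilw p p' ψ')) ?_
        ((totalDegree_mul_le_of_le htd (bild _ _ _)).trans (by norm_num))
      rw [← hχ, hψc _ hc]
      congr 1
      ext <;> simp [mul_comm, mul_left_comm]
    have hpure : ∀ {e e' : ℤˣ} (p p' : CoordPair ρ ω e) (r r' : CoordPair ρ ω e') (c : ℤˣ × ℤˣ),
        eval v (p.bil p' c * r.bil r' c) = eval w (p.bil p' c * r.bil r' c) :=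
      fun p p' r r' c => agree _ _ ((purew p p' c).mul (purew r r' c))
        (Prod.ext (hsq c) (hsqδ 1))
        ((totalDegree_mul_le_of_le (bild _ _ _) (bild _ _ _)).trans (by norm_num))
    obtain ⟨k, l, hkl⟩ := two_mul_bil_mul_bil (R := MvPolynomial ι K) a b ψ ψ' ha hb hab hc
    have hqq' : 2 * (p.bil p' ψ * p.bil p' ψ') =
      ((k : ℤ) : MvPolynomial ι K) * (p.bil p a * p'.bil p' b) +
        ((l : ℤ) : MvPolynomial ι K) * (p.bil p b * p'.bil p' a) := hkl _ _ _ _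
    have hv := congrArg (eval v) hqq'
    have hw := congrArg (eval w) hqq'
    have h1 := hpure p₁ p₁' p p a
    have h3 := hpure p₂ p₂' p' p' b
    have h4 := hpure p₁ p₁' p' p' a
    have h5 := hpure p₂ p₂' p p b
    have h6 := agree_sq ψ'
    simp only [map_mul, map_add, map_ofNat, map_intCast] at hv hw h1 h3 h4 h5 h6 ht ⊢
    have h7 : eval v (p₁.bil p₁' a) * eval v (p₂.bil p₂' b) *
        (eval v (p.bil p' ψ) * eval v (p.bil p' ψ')) =
        eval w (p₁.bil p₁' a) * eval w (p₂.bil p₂' b) *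
        (eval w (p.bil p' ψ) * eval w (p.bil p' ψ')) := by
      refine mul_left_cancel₀ h2 ?_
      linear_combination (eval v (p₁.bil p₁' a) * eval v (p₂.bil p₂' b)) * hv -
        (eval w (p₁.bil p₁' a) * eval w (p₂.bil p₂' b)) * hw +
        ((k : ℤ) : K) * (eval v (p₂.bil p₂' b) * eval v (p'.bil p' b) * h1 +
          eval w (p₁.bil p₁' a) * eval w (p.bil p a) * h3) +
        ((l : ℤ) : K) * (eval v (p₂.bil p₂' b) * eval v (p.bil p b) * h4 +
          eval w (p₁.bil p₁' a) * eval w (p'.bil p' a) * h5)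
    refine mul_right_cancel₀ (b := eval v (p.bil p' ψ') * eval v (p.bil p' ψ'))
      (mul_self_ne_zero.2 hψ') ?_
    nth_rw 2 [h6]
    linear_combination (eval v (p₁.bil p₁' a) * eval v (p₂.bil p₂' b) *
        (eval v (p.bil p' ψ) * eval v (p.bil p' ψ'))) * ht +
      (eval w t * eval w (p.bil p' ψ')) * h7

theorem sepNoetherNumberOf_le {K ι : Type*} [Field K] [Fintype ι] [DecidableEq ι]
    (h2 : (2 : K) ≠ 0) {ω : K} (hω : ω ^ 2 = -1) (ρ : Representation K Q8C2 (ι → K)) :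
    sepNoetherNumberOf ρ ≤ 6 := by
  refine iInf₂_le (6 : ℕ) fun v w h => exists_map_eq_of_eval_eq ρ v w fun f hf => ?_
  have hP : ∀ f : MvPolynomial ι K, f ∈ AlgHom.equalizer (aeval v : MvPolynomial ι K →ₐ[K] K)
      (aeval w) ↔ eval v f = eval w f := fun f => by
    simp [AlgHom.mem_equalizer, aeval_eq_eval]
  refine (hP f).1 (polyInvariants_le h2 hω _ (fun f hf => (hP f).2 (h f hf)) ?_ hf)
  intro t χ htd htw e₁ e₂ e e' p₁ p₁' p₂ p₂' p p' a b ψ _ ha hb hab hχ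
  exact (hP _).2 (eval_eq_eval_of_mixed h2 hω h t χ htd htw p₁ p₁' p₂ p₂' p p' a b ψ ha hb hab hχ)

/-! ### A five-dimensional representation -/

theorem pow_eq_pow_of_mod_eq {M : Type*} [Monoid M] {x : M} {n : ℕ} (h : x ^ n = 1) {k l : ℕ}
    (hkl : k % n = l % n) : x ^ k = x ^ l := by
  rw [pow_eq_pow_mod k h, pow_eq_pow_mod l h, hkl]

/-- The homomorphism from `Dic₈ × C₂` to a monoid determined by images of the generators that
satisfy the defining relations. -/
def homOfRelations {M : Type*} [Monoid M] (x y z : M) (hx : x ^ 4 = 1) (hy : y * y = x ^ 2)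
    (hxy : x * y = y * x ^ 3) (hz : z ^ 2 = 1) (hxz : Commute x z) (hyz : Commute y z) :
    Q8C2 →* M :=
  have hpow : ∀ n : ℕ, x ^ n * y = y * x ^ (3 * n) := fun n => by
    induction n with
    | zero => simp
    | succ n ih => rw [pow_succ, mul_assoc, hxy, ← mul_assoc, ih, mul_assoc, ← pow_add]; rfl
  let q : QuaternionGroup 2 →* M :=
    { toFun := fun
        | .a k => x ^ k.val
        | .xa k => y * x ^ k.val
      map_one' := pow_zero x
      map_mul' := by
        rintro (k | k) (l | l)
        · change x ^ (k + l).val = x ^ k.val * x ^ l.val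
          rw [← pow_add]
          exact pow_eq_pow_of_mod_eq hx (by revert k l; decide)
        · change y * x ^ (l - k).val = x ^ k.val * (y * x ^ l.val)
          rw [← mul_assoc, hpow, mul_assoc, ← pow_add]
          exact congrArg _ (pow_eq_pow_of_mod_eq hx (by revert k l; decide))
        · change y * x ^ (k + l).val = y * x ^ k.val * x ^ l.val
          rw [mul_assoc, ← pow_add]
          exact congrArg _ (pow_eq_pow_of_mod_eq hx (by revert k l; decide))
        · change x ^ ((2 : ℕ) + l - k : ZMod 4).val = y * x ^ k.val * (y * x ^ l.val)
          rw [mul_assoc, ← mul_assoc _ y, hpow, ← mul_assoc, ← mul_assoc, hy, ← pow_add, ← pow_add]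
          exact pow_eq_pow_of_mod_eq hx (by revert k l; decide) }
  let r : Multiplicative (ZMod 2) →* M :=
    { toFun := fun s => z ^ s.toAdd.val
      map_one' := pow_zero z
      map_mul' := fun s t => by
        rw [← pow_add]
        exact pow_eq_pow_of_mod_eq hz (by revert s t; decide) }
  q.noncommCoprod r fun m n => by
    rcases m with k | k
    · exact hxz.pow_pow _ _
    · exact (hyz.pow_right _).mul_left (hxz.pow_pow _ _)

section Rep

variable {K : Type*} [Field K]

/-- The matrix of `i` on `K⁵`. -/
def matI (ω : K) : Matrix (Fin 5) (Fin 5) K := Matrix.diagonal ![ω ^ 3, ω, ω ^ 3, ω, 1]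

/-- The matrix of `j` on `K⁵`. -/
def matJ : Matrix (Fin 5) (Fin 5) K :=
  !![0, -1, 0, 0, 0; 1, 0, 0, 0, 0; 0, 0, 0, -1, 0; 0, 0, 1, 0, 0; 0, 0, 0, 0, 1]

/-- The matrix of the generator of `C₂` on `K⁵`. -/
def matC : Matrix (Fin 5) (Fin 5) K := Matrix.diagonal ![1, 1, -1, -1, -1]

theorem matI_pow (ω : K) (n : ℕ) :
    matI ω ^ n = Matrix.diagonal ![(ω ^ 3) ^ n, ω ^ n, (ω ^ 3) ^ n, ω ^ n, 1] := by
  rw [matI, Matrix.diagonal_pow]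
  congr 1
  ext k
  fin_cases k <;> simp

theorem matI_sq {ω : K} (hω : ω ^ 2 = -1) :
    matI ω ^ 2 = Matrix.diagonal ![-1, -1, -1, -1, 1] := by
  rw [matI_pow, show (ω ^ 3) ^ 2 = -1 by linear_combination (ω ^ 4 - ω ^ 2 + 1) * hω, hω]

theorem matI_cube {ω : K} (hω : ω ^ 2 = -1) :
    matI ω ^ 3 = Matrix.diagonal ![ω, -ω, ω, -ω, 1] := by
  rw [matI_pow, show (ω ^ 3) ^ 3 = ω by
      linear_combination (ω ^ 7 - ω ^ 5 + ω ^ 3 - ω) * hω,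
    show ω ^ 3 = -ω by linear_combination ω * hω]

/-- The representation of `Dic₈ × C₂` on `K⁵` with coordinates `x₁, y₁, x₂, y₂, t`, the direct sum
of two copies of the faithful irreducible representation of `Dic₈`, on which `C₂` acts by `1` and
by `-1`, and of the nontrivial character of `C₂`. -/
noncomputable def rep5 {ω : K} (hω : ω ^ 2 = -1) : Representation K Q8C2 (Fin 5 → K) :=
  (Matrix.toLinAlgEquiv' : Matrix (Fin 5) (Fin 5) K ≃ₐ[K] _).toAlgHom.toMonoidHom.comp
    (homOfRelations (matI ω) matJ matC
      (by
        rw [show 4 = 2 * 2 from rfl, pow_mul, matI_sq hω, Matrix.diagonal_pow,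
          ← Matrix.diagonal_one]
        congr 1; ext k; fin_cases k <;> simp)
      (by
        rw [matI_sq hω]
        ext k l
        fin_cases k <;> fin_cases l <;> simp [matJ, Matrix.mul_apply, Fin.sum_univ_five])
      (by
        rw [matI_cube hω]
        have : ω ^ 3 = -ω := by linear_combination ω * hω
        ext k l
        fin_cases k <;> fin_cases l <;>
          simp [matI, matJ, Matrix.mul_apply, Matrix.diagonal_apply, this])
      (by
        rw [matC, Matrix.diagonal_pow, ← Matrix.diagonal_one]
        congr 1; ext k; fin_cases k <;> simp)
      (by rw [matI, matC]; exact Matrix.commute_diagonal _ _)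
      (by
        ext k l
        fin_cases k <;> fin_cases l <;>
          simp [matJ, matC, Matrix.mul_apply, Matrix.diagonal_apply]))

variable {ω : K} (hω : ω ^ 2 = -1)

theorem toMatrix'_rep5_i : LinearMap.toMatrix' (rep5 hω gI⁻¹) = matI ω ^ 3 := by
  rw [show gI⁻¹ = ((QuaternionGroup.a 3, 1) : Q8C2) by decide]
  refine (LinearMap.toMatrix'_toLin' _).trans ?_
  exact mul_one _

theorem toMatrix'_rep5_j : LinearMap.toMatrix' (rep5 hω gJ⁻¹) = matJ * matI ω ^ 2 := by
  rw [show gJ⁻¹ = ((QuaternionGroup.xa 2, 1) : Q8C2) by decide]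
  refine (LinearMap.toMatrix'_toLin' _).trans ?_
  exact mul_one _

theorem toMatrix'_rep5_c : LinearMap.toMatrix' (rep5 hω gC⁻¹) = matC := by
  rw [show gC⁻¹ = ((QuaternionGroup.a 0, Multiplicative.ofAdd 1) : Q8C2) by decide]
  refine (LinearMap.toMatrix'_toLin' _).trans ?_
  exact (one_mul _).trans (pow_one _)

theorem coordAct_rep5_i (k : Fin 5) :
    coordAct (rep5 hω) gI (X k) = C (![ω, -ω, ω, -ω, 1] k) * X k := by
  simp only [coordAct, aeval_X, toMatrix'_rep5_i hω]
  simp [matI_cube hω, Matrix.diagonal_apply,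
    apply_ite (C : K → MvPolynomial (Fin 5) K)]

theorem coordAct_rep5_c (k : Fin 5) :
    coordAct (rep5 hω) gC (X k) = C (![1, 1, -1, -1, -1] k) * X k := by
  simp only [coordAct, aeval_X, toMatrix'_rep5_c hω]
  simp [matC, Matrix.diagonal_apply,
    apply_ite (C : K → MvPolynomial (Fin 5) K)]

theorem coordAct_rep5_j (k : Fin 5) :
    coordAct (rep5 hω) gJ (X k) = ![X 1, -X 0, X 3, -X 2, X 4] k := by
  simp only [coordAct, aeval_X, toMatrix'_rep5_j hω, matI_sq hω]
  fin_cases k <;> simp [matJ, Fin.sum_univ_five]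

/-- The coordinates `x₁, y₁`. -/
noncomputable def pairPlus : CoordPair (rep5 hω) ω 1 where
  x := X 0
  y := X 1
  degree_x := (totalDegree_X _).le
  degree_y := (totalDegree_X _).le
  act_i_x := by simp [coordAct_rep5_i]
  act_i_y := by simp [coordAct_rep5_i]
  act_j_x := by simp [coordAct_rep5_j]
  act_j_y := by simp [coordAct_rep5_j]
  act_c_x := by simp [coordAct_rep5_c]
  act_c_y := by simp [coordAct_rep5_c]

/-- The coordinates `x₂, y₂`. -/
noncomputable def pairMinus : CoordPair (rep5 hω) ω (-1) where
  x := X 2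
  y := X 3
  degree_x := (totalDegree_X _).le
  degree_y := (totalDegree_X _).le
  act_i_x := by simp [coordAct_rep5_i]
  act_i_y := by simp [coordAct_rep5_i]
  act_j_x := by simp [coordAct_rep5_j]
  act_j_y := by simp [coordAct_rep5_j]
  act_c_x := by simp [coordAct_rep5_c]
  act_c_y := by simp [coordAct_rep5_c]

/-- An algebra endomorphism that rescales the variables acts diagonally on monomials. -/
theorem coeff_of_diagonal {σ : Type*} {φ : MvPolynomial σ K →ₐ[K] MvPolynomial σ K} {d : σ → K}
    (hφ : ∀ k, φ (X k) = C (d k) * X k) (f : MvPolynomial σ K) (m : σ →₀ ℕ) :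
    coeff m (φ f) = (m.prod fun k n => d k ^ n) * coeff m f := by
  classical
  have hmon : ∀ (s : σ →₀ ℕ) (a : K),
      φ (monomial s a) = monomial s ((s.prod fun k n => d k ^ n) * a) := by
    intro s a
    rw [monomial_eq, monomial_eq, map_mul, algHom_C, algebraMap_eq, Finsupp.prod, map_prod]
    simp only [map_pow, hφ, mul_pow, Finset.prod_mul_distrib, C_mul, Finsupp.prod, map_prod]
    ring
  induction f using MvPolynomial.induction_on' with
  | monomial s a =>
    rw [hmon, coeff_monomial, coeff_monomial]
    split_ifs with h
    · rw [h]
    · rw [mul_zero]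
  | add p q hp hq => rw [map_add, coeff_add, coeff_add, hp, hq, mul_add]

theorem monomial_fin_five (m : Fin 5 →₀ ℕ) : (monomial m 1 : MvPolynomial (Fin 5) K) =
    X 0 ^ m 0 * X 1 ^ m 1 * X 2 ^ m 2 * X 3 ^ m 3 * X 4 ^ m 4 := by
  rw [monomial_eq, Finsupp.prod_fintype _ _ (by simp), Fin.prod_univ_five, C_1, one_mul]

/-- The invariants of degree at most `d` are spanned by the symmetrizations under `j` of the
monomials of degree at most `d` that are invariant under `i` and `C₂`. -/
theorem mem_span_of_mem_polyInvariantsLE (h2 : (2 : K) ≠ 0) {d : ℕ} {f : MvPolynomial (Fin 5) K}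
    (hf : f ∈ polyInvariantsLE (rep5 hω) d) :
    f ∈ Submodule.span K {F : MvPolynomial (Fin 5) K | ∃ a b a' b' e : ℕ,
      a + b + a' + b' + e ≤ d ∧ (a + a') % 4 = (b + b') % 4 ∧ (a' + b' + e) % 2 = 0 ∧
      F = X 0 ^ a * X 1 ^ b * X 2 ^ a' * X 3 ^ b' * X 4 ^ e +
        X 1 ^ a * (-X 0) ^ b * X 3 ^ a' * (-X 2) ^ b' * X 4 ^ e} := by
  obtain ⟨hinv, hd⟩ := hf
  rw [mem_polyInvariants] at hinv
  have hone : ω ≠ 1 := by rintro rfl; apply h2; linear_combination hω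
  have hω4 : orderOf ω = 4 := by
    refine orderOf_eq_prime_pow (p := 2) (n := 1) ?_ (by linear_combination (ω ^ 2 - 1) * hω)
    rw [pow_one, hω]
    intro h
    apply h2
    linear_combination -h
  have hm1 : orderOf (-1 : K) = 2 := by
    refine orderOf_eq_prime (by ring) ?_
    intro h
    apply h2
    linear_combination -h
  have hJ : f = (2⁻¹ : K) • ∑ m ∈ f.support,
      coeff m f • (monomial m (1 : K) + coordAct (rep5 hω) gJ (monomial m 1)) := by
    have h1 : ∑ m ∈ f.support, coeff m f • (monomial m (1 : K)) = f := by
      conv_rhs => rw [f.as_sum]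
      exact Finset.sum_congr rfl fun m _ => by rw [smul_monomial, smul_eq_mul, mul_one]
    have h3 : ∑ m ∈ f.support, coeff m f • coordAct (rep5 hω) gJ (monomial m (1 : K)) = f := by
      conv_rhs => rw [← hinv gJ, ← h1, map_sum]
      simp only [map_smul]
    simp only [smul_add]
    rw [Finset.sum_add_distrib, h1, h3, ← two_smul K f, smul_smul, inv_mul_cancel₀ h2, one_smul]
  rw [hJ]
  refine Submodule.smul_mem _ _ (sum_mem fun m hm => Submodule.smul_mem _ _
    (Submodule.subset_span ⟨m 0, m 1, m 2, m 3, m 4, ?_, ?_, ?_, ?_⟩))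
  · refine le_trans (le_of_eq ?_) ((le_totalDegree hm).trans hd)
    rw [Finsupp.sum_fintype _ _ (by simp), Fin.sum_univ_five]
  · have h := coeff_of_diagonal (coordAct_rep5_i hω) f m
    rw [hinv, eq_comm] at h
    have h := mul_eq_right₀ (mem_support_iff.1 hm) |>.1 h
    rw [Finsupp.prod_fintype _ _ (by simp), Fin.prod_univ_five] at h
    have h3 : -ω = ω ^ 3 := by linear_combination -ω * hω
    simp only [Matrix.cons_val, one_pow, mul_one, h3, ← pow_mul, ← pow_add] at h
    have := orderOf_dvd_of_pow_eq_one h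
    rw [hω4] at this
    omega
  · have h := coeff_of_diagonal (coordAct_rep5_c hω) f m
    rw [hinv, eq_comm] at h
    have h := mul_eq_right₀ (mem_support_iff.1 hm) |>.1 h
    rw [Finsupp.prod_fintype _ _ (by simp), Fin.prod_univ_five] at h
    simp only [Matrix.cons_val, one_pow, one_mul, ← pow_add] at h
    have := orderOf_dvd_of_pow_eq_one h
    rw [hm1] at this
    omega
  · simp only [monomial_fin_five, map_mul, map_pow, coordAct_rep5_j, Matrix.cons_val]

end Rep

section Lower

variable {K : Type*} [Field K] {ω : K}

/-! ### The lower bound for the separating Noether number -/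

/-- If `ζ ^ 4 = -1`, the points `(1, ζ)` and `(1, -ζ)` of the faithful representation of `Dic₈` lie
in different orbits, since the invariant `x y (x ^ 4 - y ^ 4)` takes different values. -/
theorem not_exists_map_eq (h2 : (2 : K) ≠ 0) (hω : ω ^ 2 = -1) {ζ : K} (hζ : ζ ^ 4 = -1) :
    ¬ ∃ g, rep5 hω g ![1, ζ, 0, 0, 0] = ![1, -ζ, 0, 0, 0] := by
  rintro ⟨g, hg⟩
  let p := pairPlus hω
  have hw := (p.hasWeight_bil hω p (-1, 1)).mul ((p.hasWeight_bil hω p (-1, -1)).mul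
    (p.hasWeight_bil hω p (1, -1)))
  have hinv : p.bil p (-1, 1) * (p.bil p (-1, -1) * p.bil p (1, -1)) ∈ polyInvariants (rep5 hω) :=
    HasWeight.mem_polyInvariants hw
  have h := eval_coordAct (rep5 hω) g⁻¹
    (p.bil p (-1, 1) * (p.bil p (-1, -1) * p.bil p (1, -1))) ![1, ζ, 0, 0, 0]
  rw [mem_polyInvariants.1 hinv, inv_inv, hg] at h
  have hζ0 : ζ ≠ 0 := by rintro rfl; simp at hζ
  simp [p, CoordPair.bil, bil, pairPlus] at h
  rcases h with (h | h) | h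
  · exact mul_ne_zero (pow_ne_zero 2 h2) hζ0 (by linear_combination h)
  · exact h2 (by linear_combination (1 + ζ ^ 2) * h + hζ)
  · exact h2 (by linear_combination (1 - ζ ^ 2) * h + hζ)

theorem eval_eq_eval_of_mem_polyInvariantsLE (h2 : (2 : K) ≠ 0) (hω : ω ^ 2 = -1) (ζ : K)
    {f : MvPolynomial (Fin 5) K} (hf : f ∈ polyInvariantsLE (rep5 hω) 5) :
    eval ![1, ζ, 0, 0, 0] f = eval ![1, -ζ, 0, 0, 0] f := by
  have h := mem_span_of_mem_polyInvariantsLE hω h2 hf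
  clear hf
  induction h using Submodule.span_induction with
  | zero => simp
  | add f g _ _ hf hg => rw [map_add, map_add, hf, hg]
  | smul c f _ hf => rw [smul_eval, smul_eval, hf]
  | mem F hF =>
    obtain ⟨a, b, a', b', e, hd, h4, -, rfl⟩ := hF
    simp only [map_add, map_mul, map_pow, map_neg, eval_X, Matrix.cons_val]
    by_cases h0 : a' + b' + e = 0
    · obtain ⟨rfl, rfl, rfl⟩ : a' = 0 ∧ b' = 0 ∧ e = 0 := by omega
      -- The only monomial of odd degrees in `x` and `y` is `x y`, whose symmetrization is zero.
      by_cases hb : Even b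
      · have ha : Even a := by rw [Nat.even_iff] at hb ⊢; omega
        rw [ha.neg_pow, hb.neg_pow, hb.neg_pow]
      · obtain ⟨rfl, rfl⟩ : a = 1 ∧ b = 1 := by rw [Nat.even_iff] at hb; omega
        ring
    · rcases Nat.eq_zero_or_pos a' with rfl | h
      · rcases Nat.eq_zero_or_pos b' with rfl | h
        · simp [zero_pow (show e ≠ 0 by omega)]
        · simp [zero_pow h.ne']
      · simp [zero_pow h.ne']

theorem le_sepNoetherNumberOf_rep5 (h2 : (2 : K) ≠ 0) (hω : ω ^ 2 = -1) {ζ : K}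
    (hζ : ζ ^ 4 = -1) : 6 ≤ sepNoetherNumberOf (rep5 hω) := by
  refine le_iInf₂ fun d hd => ?_
  by_contra hlt
  have hlt : d ≤ 5 := by
    have : ¬ 6 ≤ d := fun h => hlt (by exact_mod_cast h)
    omega
  exact not_exists_map_eq h2 hω hζ (hd _ _ fun f hf =>
    eval_eq_eval_of_mem_polyInvariantsLE h2 hω ζ ⟨hf.1, hf.2.trans hlt⟩)

/-! ### The lower bound for the Noether number -/

/-- The exponents `n` of the monomials `x ^ n 0 * y ^ n 1 * t ^ n 2` dividing `x ^ 5 * y * t` other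
than `1`, `x ^ 4`, `x ^ 4 * t`, `x ^ 5 * y`. In each factorization of one of these monomials one
of the two factors is among them. -/
def Excluded (n : Fin 3 →₀ ℕ) : Prop :=
  n 0 ≤ 5 ∧ n 1 ≤ 1 ∧ n 2 ≤ 1 ∧ ¬ (n 0 = 0 ∧ n 1 = 0 ∧ n 2 = 0) ∧ ¬ (n 0 = 4 ∧ n 1 = 0) ∧
    ¬ (n 0 = 5 ∧ n 1 = 1 ∧ n 2 = 0)

variable (K) in
/-- The subalgebra of all polynomials in which no excluded monomial occurs. -/
noncomputable def avoiding : Subalgebra K (MvPolynomial (Fin 3) K) where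
  carrier := {F | ∀ n, Excluded n → coeff n F = 0}
  add_mem' := fun {F G} hF hG n hn => by rw [coeff_add, hF n hn, hG n hn, add_zero]
  mul_mem' := fun {F G} hF hG n hn => by
    rw [coeff_mul]
    refine Finset.sum_eq_zero fun k hk => ?_
    have hk' := Finset.HasAntidiagonal.mem_antidiagonal.1 hk
    have h0 := DFunLike.congr_fun hk' 0
    have h1 := DFunLike.congr_fun hk' 1
    have h2 := DFunLike.congr_fun hk' 2
    simp only [Finsupp.add_apply] at h0 h1 h2
    have : Excluded k.1 ∨ Excluded k.2 := by
      unfold Excluded at hn ⊢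
      omega
    rcases this with h | h
    · rw [hF _ h, zero_mul]
    · rw [hG _ h, mul_zero]
  algebraMap_mem' := fun r n hn => by
    rw [algebraMap_eq, coeff_C, if_neg]
    rintro rfl
    exact hn.2.2.2.1 ⟨rfl, rfl, rfl⟩

theorem monomial_fin_three (a b c : ℕ) : (X 0 ^ a * X 1 ^ b * X 2 ^ c : MvPolynomial (Fin 3) K) =
    monomial (Finsupp.single 0 a + Finsupp.single 1 b + Finsupp.single 2 c) 1 := by
  simp [X_pow_eq_monomial, monomial_mul]

theorem monomial_mem_avoiding {a b c : ℕ}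
    (h : ¬ Excluded (Finsupp.single 0 a + Finsupp.single 1 b + Finsupp.single 2 c)) :
    (X 0 ^ a * X 1 ^ b * X 2 ^ c : MvPolynomial (Fin 3) K) ∈ avoiding K := by
  intro n hn
  rw [monomial_fin_three, coeff_monomial, if_neg]
  rintro rfl
  exact h hn

theorem excluded_iff (a b c : ℕ) :
    Excluded (Finsupp.single 0 a + Finsupp.single 1 b + Finsupp.single 2 c) ↔
      a ≤ 5 ∧ b ≤ 1 ∧ c ≤ 1 ∧ ¬ (a = 0 ∧ b = 0 ∧ c = 0) ∧ ¬ (a = 4 ∧ b = 0) ∧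
        ¬ (a = 5 ∧ b = 1 ∧ c = 0) := by
  simp [Excluded]

variable (K) in
/-- The restriction of polynomials to the subspace `x₁ = x₂`, `y₁ = y₂`. -/
noncomputable def diagonalRestriction : MvPolynomial (Fin 5) K →ₐ[K] MvPolynomial (Fin 3) K :=
  aeval ![X 0, X 1, X 0, X 1, X 2]

theorem diagonalRestriction_mem (h2 : (2 : K) ≠ 0) (hω : ω ^ 2 = -1) {f : MvPolynomial (Fin 5) K}
    (hf : f ∈ polyInvariantsLE (rep5 hω) 6) : diagonalRestriction K f ∈ avoiding K := by
  have h := mem_span_of_mem_polyInvariantsLE hω h2 hf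
  clear hf
  induction h using Submodule.span_induction with
  | zero => rw [map_zero]; exact zero_mem _
  | add f g _ _ hf hg => rw [map_add]; exact add_mem hf hg
  | smul c f _ hf => rw [map_smul]; exact Subalgebra.smul_mem _ hf c
  | mem F hF =>
    obtain ⟨a, b, a', b', e, hd, h4, he, rfl⟩ := hF
    have hrw : diagonalRestriction K (X 0 ^ a * X 1 ^ b * X 2 ^ a' * X 3 ^ b' * X 4 ^ e +
        X 1 ^ a * (-X 0) ^ b * X 3 ^ a' * (-X 2) ^ b' * X 4 ^ e) =
        X 0 ^ (a + a') * X 1 ^ (b + b') * X 2 ^ e +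
          (-1 : K) ^ (b + b') • (X 0 ^ (b + b') * X 1 ^ (a + a') * X 2 ^ e) := by
      simp only [diagonalRestriction, map_add, map_mul, map_pow, map_neg, aeval_X,
        Matrix.cons_val, smul_eq_C_mul, C_1]
      rw [neg_pow (X 0 : MvPolynomial (Fin 3) K) b, neg_pow (X 0 : MvPolynomial (Fin 3) K) b']
      ring
    rw [hrw]
    by_cases h1 : a + a' = 1 ∧ b + b' = 1
    · rw [h1.1, h1.2]
      convert zero_mem (avoiding K) using 1
      simp
    · refine add_mem (monomial_mem_avoiding ?_)
        (Subalgebra.smul_mem _ (monomial_mem_avoiding ?_) _)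
      · rw [excluded_iff]; omega
      · rw [excluded_iff]; omega

/-- The invariant of degree `7` that is the product of `t` with the three symmetric bilinear forms
in `(x₁, y₁)` and `(x₂, y₂)`. -/
noncomputable def invSeven (hω : ω ^ 2 = -1) : MvPolynomial (Fin 5) K :=
  X 4 * ((pairPlus hω).bil (pairMinus hω) (-1, 1) * ((pairPlus hω).bil (pairMinus hω) (-1, -1) *
    (pairPlus hω).bil (pairMinus hω) (1, -1)))

theorem invSeven_mem (hω : ω ^ 2 = -1) : invSeven hω ∈ polyInvariants (rep5 hω) := by
  have ht : HasWeight (rep5 hω) (X 4) (1, -1) := by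
    refine ⟨?_, ?_, ?_⟩
    · simp [coordAct_rep5_i]
    · simp [coordAct_rep5_j]
    · simp [coordAct_rep5_c]
  have hw := ht.mul (((pairPlus hω).hasWeight_bil hω (pairMinus hω) (-1, 1)).mul
    (((pairPlus hω).hasWeight_bil hω (pairMinus hω) (-1, -1)).mul
      ((pairPlus hω).hasWeight_bil hω (pairMinus hω) (1, -1))))
  rw [show ((1, -1) * (((-1, 1), 1 * -1) * (((-1, -1), 1 * -1) * ((1, -1), 1 * -1))) :
    (ℤˣ × ℤˣ) × ℤˣ) = 1 by decide] at hw
  exact hw.mem_polyInvariants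

theorem diagonalRestriction_invSeven_notMem (h2 : (2 : K) ≠ 0) (hω : ω ^ 2 = -1) :
    diagonalRestriction K (invSeven hω) ∉ avoiding K := by
  intro h
  have hrw : diagonalRestriction K (invSeven hω) =
      (2 : K) • (X 0 ^ 5 * X 1 ^ 1 * X 2 ^ 1) - (2 : K) • (X 0 ^ 1 * X 1 ^ 5 * X 2 ^ 1) := by
    simp [invSeven, diagonalRestriction, CoordPair.bil, bil, pairPlus, pairMinus, smul_eq_C_mul,
      show (C (2 : K) : MvPolynomial (Fin 3) K) = 2 from map_ofNat C 2]
    ring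
  rw [hrw] at h
  have h0 := h _ ((excluded_iff 5 1 1).2 (by omega))
  rw [monomial_fin_three, monomial_fin_three, coeff_sub, coeff_smul, coeff_smul, coeff_monomial,
    coeff_monomial, if_pos rfl, if_neg, smul_zero, sub_zero, smul_eq_mul, mul_one] at h0
  · exact h2 h0
  · intro h
    have := DFunLike.congr_fun h 0
    simp at this

theorem le_noetherNumberOf_rep5 (h2 : (2 : K) ≠ 0) (hω : ω ^ 2 = -1) :
    7 ≤ noetherNumberOf (rep5 hω) := by
  refine le_iInf₂ fun d hd => ?_
  by_contra hlt
  have hlt : d ≤ 6 := by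
    have : ¬ 7 ≤ d := fun h => hlt (by exact_mod_cast h)
    omega
  have hle : Algebra.adjoin K (polyInvariantsLE (rep5 hω) d) ≤
      (avoiding K).comap (diagonalRestriction K) :=
    Algebra.adjoin_le fun f hf => diagonalRestriction_mem h2 hω ⟨hf.1, hf.2.trans hlt⟩
  rw [hd] at hle
  exact diagonalRestriction_invSeven_notMem h2 hω (hle (invSeven_mem hω))

end Lower

end Dic8C2

/-- `QuaternionGroup 2` is the quaternion group `Dic₈` of order `8`. -/
theorem theorem5p4 {K : Type*} [Field K] (hK : ∃ ζ : K, orderOf ζ = 8) :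
    sepNoetherNumber K (QuaternionGroup 2 × Multiplicative (ZMod 2)) = 6 ∧
      noetherNumber K (QuaternionGroup 2 × Multiplicative (ZMod 2)) = 7 := by
  obtain ⟨ζ, hζ⟩ := hK
  have h8 : ζ ^ 8 = 1 := hζ ▸ pow_orderOf_eq_one ζ
  have h4 : ζ ^ 4 ≠ 1 := fun h => by
    have := orderOf_dvd_of_pow_eq_one h
    rw [hζ] at this
    omega
  have hζ4 : ζ ^ 4 = -1 := by
    have : (ζ ^ 4 - 1) * (ζ ^ 4 + 1) = 0 := by linear_combination h8
    exact eq_neg_of_add_eq_zero_left ((mul_eq_zero.1 this).resolve_left (sub_ne_zero.2 h4))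
  have hω : (ζ ^ 2) ^ 2 = -1 := by rw [← pow_mul]; exact hζ4
  have h2 : (2 : K) ≠ 0 := fun h => h4 (by linear_combination hζ4 - h)
  constructor
  · refine le_antisymm (iSup₂_le fun n ρ => Dic8C2.sepNoetherNumberOf_le h2 hω ρ) ?_
    exact (Dic8C2.le_sepNoetherNumberOf_rep5 h2 hω hζ4).trans
      (le_iSup₂ (f := fun (n : ℕ) (ρ : Representation K Dic8C2.Q8C2 (Fin n → K)) =>
        sepNoetherNumberOf ρ) 5 (Dic8C2.rep5 hω))
  · refine le_antisymm (iSup₂_le fun n ρ => Dic8C2.noetherNumberOf_le h2 hω ρ) ?_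
    exact (Dic8C2.le_noetherNumberOf_rep5 h2 hω).trans
      (le_iSup₂ (f := fun (n : ℕ) (ρ : Representation K Dic8C2.Q8C2 (Fin n → K)) =>
        noetherNumberOf ρ) 5 (Dic8C2.rep5 hω))
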